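/- Let $n\ge 1$, and let $A$ be a real symmetric $n\times n$ matrix all of whose eigenvalues are positive; let $\sigma(A)$ be its set of eigenvalues, $\Lambda_1$ and $\Lambda_n$ the smallest and the largest of them, and, for $\Lambda\in\sigma(A)$, let $R_\Lambda$ be the orthogonal projection of $\mathbb R^n$ onto the eigenspace of $A$ for $\Lambda$. Let $\alpha>0$ and let $H:\mathbb R^n\setminus\{0\}\to\mathbb R$ be positively homogeneous of degree $\alpha$ (that is, $H(sx)=s^\alpha H(x)$ for $s>0$, $x\neq0$), positive and continuous on the unit sphere $\mathbb S^{n-1}$. Let $0\le t_0<T_*<\infty$, and let $y\in C^1([t_0,T_*),\mathbb R^n)$ satisfy $y(t)\ne0$ for all $t\in[t_0,T_*)$, $|y(t)|\to\infty$ as $t\to T_*^-$, and $$y'=H(y)Ay+f(t)\quad\text{on }(t_0,T_*),$$ where $f:[t_0,T_*)\to\mathbb R^n$ is continuous and $|f(t)|\le|y(t)|^{1+\alpha}E_0(t)$ on $[t_0,T_*)$ for some integrable $E_0:[t_0,T_*)\to[0,\infty)$. Assume $$Z_1=\int_{t_0}^{T_*}\frac{E_0(\tau)}{T_*-\tau}\,d\tau<\infty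 .$$ For $t\in[t_0,T_*)$ put $\lambda(t)=\dfrac{y(t)\cdot Ay(t)}{|y(t)|^2}$, $v(t)=\dfrac{y(t)}{|y(t)|}$, $E_1(t)=\displaystyle\int_t^{T_*}\frac{E_0(\tau)}{T_*-\tau}\,d\tau$. All $\mathcal O$-estimates below are as $t\to T_*^-$. (a) The limit $\Lambda=\lim_{t\to T_*^-}\lambda(t)$ exists and is an eigenvalue of $A$. Set $V_1(t)=|(I-R_\Lambda)v(t)|$. (b) Assume in addition that, if $\Lambda_1<\Lambda_n$, then $Z_2=\int_{t_0}^{T_*}(T_*-\tau)^{-1}E_0^2(\tau)\,d\tau<\infty$, and set $E_2(t)=\big(\int_t^{T_*}(T_*-\tau)^{-1}E_0^2(\tau)\,d\tau\big)^{1/2}$. Then $(I-R_\Lambda)v(t)\to0$ as $t\to T_*^-$. Moreover, if $\Lambda_1=\Lambda_n$, then $V_1=0$ on $[t_0,T_*)$; if $\Lambda_1=\Lambda<\Lambda_n$, then $V_1(t)=\mathcal O(E_2(t))$; and if $\Lambda_1<\Lambda\le\Lambda_n$, then there is $\theta_0>0$ such that, for every $\varepsilon\in(0,1)$, $V_1(t)=\mathcal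 O\big((T_*-t)^{(1-\varepsilon)\theta_0}+E_2(T_*-(T_*-t)^\varepsilon)\big)$. (c) Assume in addition to (b) that $Z_3=\int_{t_0}^{T_*}\frac{E_1(\tau)}{T_*-\tau}\,d\tau<\infty$. Then there is a unit vector $v_*$ with $|R_\Lambda v(t)-v_*|=\mathcal O(V_1(t)+E_1(t))$; also $v(t)\to v_*$ as $t\to T_*^-$, and $V_2(t):=|v(t)-v_*|=\mathcal O(V_1(t)+E_1(t))$. (d) Under the assumptions of (c), let $s_0>0$ and let $\omega:[0,s_0]\to[0,\infty)$ be nondecreasing with $\lim_{s\to0^+}\omega(s)=\omega(0)=0$ and $|H(x)-H(v_*)|\le\omega(|x-v_*|)$ for all $x\in\mathbb S^{n-1}$ with $|x-v_*|\le s_0$. Let $T_1\in[t_0,T_*)$ be such that $V_2(t)\le s_0$ on $[T_1,T_*)$, put $\mathcal E_0(t)=\omega(V_2(t))+V_1(t)+E_0(t)$ for $t\in[T_1,T_*)$, assume $$\int_{T_1}^{T_*}\frac{\mathcal E_0(\tau)}{T_*-\tau}\,d\tau<\infty,$$ and set $\mathcal E_1(t)=\int_t^{T_*}\frac{\mathcal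 E_0(\tau)}{T_*-\tau}\,d\tau$. Then $\lim_{t\to T_*^-}(T_*-t)^{1/\alpha}y(t)=\xi_*$ exists and is nonzero, $\xi_*$ is an eigenvector of $A$ for $\Lambda$, $\alpha\Lambda H(\xi_*)=1$, and $$(T_*-t)^{1/\alpha}|(I-R_\Lambda)y(t)|=\mathcal O(V_1(t)),\qquad |(T_*-t)^{1/\alpha}R_\Lambda y(t)-\xi_*|=\mathcal O(\mathcal E_1(t)),$$ $$|(T_*-t)^{1/\alpha}y(t)-\xi_*|=\mathcal O(V_1(t)+\mathcal E_1(t)).$$ -/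

import Mathlib

open Set Filter Topology MeasureTheory Asymptotics

namespace BlowUp

noncomputable section

/-- The phase space `ℝⁿ` with its Euclidean norm. -/
abbrev Vec (n : ℕ) : Type := EuclideanSpace ℝ (Fin n)

/-- `F` is positively homogeneous of degree `β` on `ℝⁿ \ {0}` (the value at `0` is irrelevant). -/
def PosHomogeneous {n : ℕ} (β : ℝ) (F : Vec n → ℝ) : Prop :=
  ∀ x : Vec n, x ≠ 0 → ∀ s : ℝ, 0 < s → F (s • x) = s ^ β * F x

/-- The matrix `A` as a linear operator of `ℝⁿ`. -/
abbrev op {n : ℕ} (A : Matrix (Fin n) (Fin n) ℝ) : Vec n →ₗ[ℝ] Vec n :=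
  Matrix.toEuclideanLin A

/-- The set `σ(A)` of (real) eigenvalues of `A`. -/
def eigs {n : ℕ} (A : Matrix (Fin n) (Fin n) ℝ) : Set ℝ :=
  {μ | Module.End.HasEigenvalue (op A) μ}

/-- The smallest eigenvalue `Λ₁` (`σ(A)` is finite, and nonempty for symmetric `A`, `n ≥ 1`). -/
def eigMin {n : ℕ} (A : Matrix (Fin n) (Fin n) ℝ) : ℝ := sInf (eigs A)

/-- The largest eigenvalue `Λₙ`. -/
def eigMax {n : ℕ} (A : Matrix (Fin n) (Fin n) ℝ) : ℝ := sSup (eigs A)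

/-- `R_Λ`: the orthogonal projection of `ℝⁿ` onto the eigenspace of `A` for `Λ`. -/
def proj {n : ℕ} (A : Matrix (Fin n) (Fin n) ℝ) (Λ : ℝ) : Vec n →L[ℝ] Vec n :=
  (Module.End.eigenspace (op A) Λ).starProjection

/-- The Dirichlet quotient `λ(t) = y(t) · A y(t) / |y(t)|²`. -/
def dirichletQuotient {n : ℕ} (A : Matrix (Fin n) (Fin n) ℝ) (y : ℝ → Vec n) (t : ℝ) : ℝ :=
  inner ℝ (y t) (op A (y t)) / ‖y t‖ ^ 2

/-- The normalized solution `v(t) = y(t) / |y(t)|`. -/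
def normalized {n : ℕ} (y : ℝ → Vec n) (t : ℝ) : Vec n := ‖y t‖⁻¹ • y t

/-- `E₁(t) = ∫_t^{T} E₀(τ) / (T - τ) dτ`. -/
def E1 (E0 : ℝ → ℝ) (T t : ℝ) : ℝ := ∫ τ in t..T, E0 τ / (T - τ)

/-- `E₂(t) = (∫_t^{T} E₀(τ)² / (T - τ) dτ)^{1/2}`. -/
def E2 (E0 : ℝ → ℝ) (T t : ℝ) : ℝ := Real.sqrt (∫ τ in t..T, (T - τ)⁻¹ * E0 τ ^ 2)

/-- `V₁(t) = |(I - R_Λ) v(t)|`. -/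
def V1 {n : ℕ} (A : Matrix (Fin n) (Fin n) ℝ) (Λ : ℝ) (y : ℝ → Vec n) (t : ℝ) : ℝ :=
  ‖normalized y t - proj A Λ (normalized y t)‖

/-- `V₂(t) = |v(t) - v_*|`. -/
def V2 {n : ℕ} (y : ℝ → Vec n) (vstar : Vec n) (t : ℝ) : ℝ := ‖normalized y t - vstar‖

/-- `𝓔₀(t) = ω(V₂(t)) + V₁(t) + E₀(t)`. -/
def calE0 {n : ℕ} (A : Matrix (Fin n) (Fin n) ℝ) (Λ : ℝ) (y : ℝ → Vec n) (E0 : ℝ → ℝ)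
    (vstar : Vec n) (ω : ℝ → ℝ) (t : ℝ) : ℝ :=
  ω (V2 y vstar t) + V1 A Λ y t + E0 t

/-- `𝓔₁(t) = ∫_t^{T} 𝓔₀(τ) / (T - τ) dτ`. -/
def calE1 {n : ℕ} (A : Matrix (Fin n) (Fin n) ℝ) (Λ : ℝ) (y : ℝ → Vec n) (E0 : ℝ → ℝ)
    (vstar : Vec n) (ω : ℝ → ℝ) (T t : ℝ) : ℝ :=
  ∫ τ in t..T, calE0 A Λ y E0 vstar ω τ / (T - τ)

/-- `ω`, considered on `[0, s₀]`, is a modulus of continuity of `H` at `v_*` along the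
unit sphere. -/
structure IsModulusAt {n : ℕ} (H : Vec n → ℝ) (vstar : Vec n) (s₀ : ℝ) (ω : ℝ → ℝ) : Prop where
  pos : 0 < s₀
  nonneg : ∀ s ∈ Icc 0 s₀, 0 ≤ ω s
  mono : MonotoneOn ω (Icc 0 s₀)
  zero : ω 0 = 0
  tendsto_zero : Tendsto ω (𝓝[>] 0) (𝓝 0)
  bound : ∀ x : Vec n, ‖x‖ = 1 → ‖x - vstar‖ ≤ s₀ → |H x - H vstar| ≤ ω ‖x - vstar‖

end

end BlowUp

open BlowUp

namespace BlowUp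

/-! The function `‖y‖ ^ (-α)` vanishes at the blow-up time `T`. By homogeneity its derivative is `-α
H(v) λ` up to an error of size `α E0`. Compactness of the sphere and positivity of the spectrum keep
`H(v) λ` between positive constants, so `‖y‖ ^ (-α)` is comparable with `T - t`, and hence `H(y)` is
comparable with `1 / (T - t)`.

In an orthonormal eigenbasis the coordinates of `v` then satisfy `c_i' = h (μ_i - λ) c_i + F_i`,
with `h` of order `1 / (T - t)` and `F_i = O(E0 / (T - t))`. The logarithmic divergence of `∫ dt /
(T - t)` drives everything. First, `λ'` equals `2 h` times the variance of the `μ_i` with weights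
`c_i ^ 2`, up to an integrable error. So `λ` converges, and a limit outside the spectrum would force
logarithmic growth of a bounded function (`exists_rayleigh_lim`, `lim_mem_range`).

Once `λ` is near its limit `Λ`, modes with `μ_i > Λ` are repelled from zero and must already be
small for `c_i ^ 2` to stay bounded (`le_tail_of_unstable`). Modes with `μ_i < Λ` decay like a power
of `T - t` up to the forcing (`le_of_stable`). For the neutral modes the drift `Λ - λ` is quadratic
in the transverse part. Integrating the equation for `λ` once more shows that this quadratic
quantity is integrable against `1 / (T - t)` and bounds its tail (`exists_transverse_integrable`),
so these modes converge, to the coordinates of `v_*`.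

Finally, inserting `H(v) → H(v_*)` and `λ → Λ` into the equation for `‖y‖ ^ (-α)` gives `‖y‖ ^ (-α)
/ (T - t) → α Λ H(v_*)` with a rate. Combining this radius with the direction `v` yields the
profile. -/

/-! ### Tail integrals up to the singular time. -/

lemma intervalIntegrable_of_Ico {k : ℝ → ℝ} {a T s t : ℝ} (hk : IntegrableOn k (Ico a T))
    (has : a ≤ s) (hst : s ≤ t) (htT : t ≤ T) : IntervalIntegrable k volume s t :=
  (intervalIntegrable_iff_integrableOn_Ico_of_le hst).2
    (hk.mono_set (Ico_subset_Ico has htT))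

lemma integrableOn_Icc_of_Ico {k : ℝ → ℝ} {a T s t : ℝ} (hk : IntegrableOn k (Ico a T))
    (has : a ≤ s) (htT : t < T) : IntegrableOn k (Icc s t) :=
  hk.mono_set fun _ hx => ⟨has.trans hx.1, hx.2.trans_lt htT⟩

lemma integral_le_tail {k : ℝ → ℝ} {a T s t : ℝ} (hk : IntegrableOn k (Ico a T))
    (hk0 : ∀ τ ∈ Ico a T, 0 ≤ k τ) (has : a ≤ s) (hst : s ≤ t) (htT : t ≤ T) :
    ∫ τ in s..t, k τ ≤ ∫ τ in s..T, k τ := by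
  rw [← intervalIntegral.integral_add_adjacent_intervals
    (intervalIntegrable_of_Ico hk has hst htT)
    (intervalIntegrable_of_Ico hk (has.trans hst) htT le_rfl)]
  have : 0 ≤ ∫ τ in t..T, k τ := by
    -- The open interval discards the endpoint `T`, where the sign of `k` is unknown.
    rw [intervalIntegral.integral_of_le htT, integral_Ioc_eq_integral_Ioo]
    exact setIntegral_nonneg measurableSet_Ioo
      fun x hx => hk0 x ⟨(has.trans hst).trans hx.1.le, hx.2⟩
  linarith

lemma tail_anti {k : ℝ → ℝ} {a T s t : ℝ} (hk : IntegrableOn k (Ico a T))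
    (hk0 : ∀ τ ∈ Ico a T, 0 ≤ k τ) (has : a ≤ s) (hst : s ≤ t) (htT : t ≤ T) :
    ∫ τ in t..T, k τ ≤ ∫ τ in s..T, k τ := by
  rw [← intervalIntegral.integral_add_adjacent_intervals
    (intervalIntegrable_of_Ico hk has hst htT)
    (intervalIntegrable_of_Ico hk (has.trans hst) htT le_rfl)]
  have : 0 ≤ ∫ τ in s..t, k τ := by
    rw [intervalIntegral.integral_of_le hst, integral_Ioc_eq_integral_Ioo]
    exact setIntegral_nonneg measurableSet_Ioo
      fun x hx => hk0 x ⟨has.trans hx.1.le, hx.2.trans_le htT⟩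
  linarith

lemma tail_nonneg {k : ℝ → ℝ} {a T s : ℝ} (hk0 : ∀ τ ∈ Ico a T, 0 ≤ k τ) (has : a ≤ s)
    (hsT : s ≤ T) : 0 ≤ ∫ τ in s..T, k τ := by
  rw [intervalIntegral.integral_of_le hsT, integral_Ioc_eq_integral_Ioo]
  exact setIntegral_nonneg measurableSet_Ioo fun x hx => hk0 x ⟨has.trans hx.1.le, hx.2⟩

/-- Comparison of tail integrals; nothing is asked of the endpoint `T`. -/
lemma tail_mono {k l : ℝ → ℝ} {a T s : ℝ} (hk : IntegrableOn k (Ico a T))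
    (hl : IntegrableOn l (Ico a T)) (hkl : ∀ τ ∈ Ico a T, k τ ≤ l τ) (has : a ≤ s)
    (hsT : s ≤ T) : ∫ τ in s..T, k τ ≤ ∫ τ in s..T, l τ := by
  rw [intervalIntegral.integral_of_le hsT, intervalIntegral.integral_of_le hsT,
    integral_Ioc_eq_integral_Ioo, integral_Ioc_eq_integral_Ioo]
  have hsub : Ioo s T ⊆ Ico a T := fun x hx => ⟨has.trans hx.1.le, hx.2⟩
  exact setIntegral_mono_on (hk.mono_set hsub) (hl.mono_set hsub) measurableSet_Ioo
    fun x hx => hkl x (hsub hx)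

lemma tail_tendsto {k : ℝ → ℝ} {a T : ℝ} (haT : a < T) (hk : IntegrableOn k (Ico a T)) :
    Tendsto (fun t => ∫ τ in t..T, k τ) (𝓝[<] T) (𝓝 0) := by
  have h1 : IntegrableOn k (uIcc a T) := by
    rw [uIcc_of_le haT.le]
    exact (integrableOn_Icc_iff_integrableOn_Ico).2 hk
  have h2 := intervalIntegral.continuousOn_primitive_interval_left h1 T right_mem_uIcc
  rw [ContinuousWithinAt, intervalIntegral.integral_same, uIcc_of_le haT.le] at h2
  refine h2.mono_left ?_
  rw [← nhdsWithin_Ico_eq_nhdsLT haT]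
  exact nhdsWithin_mono _ Ico_subset_Icc_self

/-! ### Differential inequalities on a half-open interval. -/

/-- One-sided fundamental theorem of calculus: only the lower bound `-k` has to be integrable, not
the derivative itself. -/
lemma le_add_integral {φ φ' k : ℝ → ℝ} {a T s t : ℝ} (hc : ContinuousOn φ (Ico a T))
    (hd : ∀ τ ∈ Ioo a T, HasDerivAt φ (φ' τ) τ) (has : a ≤ s) (hst : s ≤ t) (htT : t < T)
    (hk : IntegrableOn k (Icc s t)) (hle : ∀ τ ∈ Ioo s t, -k τ ≤ φ' τ) :
    φ s ≤ φ t + ∫ τ in s..t, k τ := by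
  have := intervalIntegral.integral_le_sub_of_hasDeriv_right_of_le (g := φ) (g' := φ')
    (φ := fun τ => -k τ) hst
    (hc.mono fun x hx => ⟨has.trans hx.1, hx.2.trans_lt htT⟩)
    (fun x hx => (hd x ⟨has.trans_lt hx.1, hx.2.trans htT⟩).hasDerivWithinAt) hk.neg hle
  rw [intervalIntegral.integral_neg] at this
  linarith

lemma le_lim_add_tail {φ φ' k : ℝ → ℝ} {a T s l : ℝ} (hc : ContinuousOn φ (Ico a T))
    (hd : ∀ τ ∈ Ioo a T, HasDerivAt φ (φ' τ) τ) (has : a ≤ s) (hsT : s < T)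
    (hk : IntegrableOn k (Ico s T)) (hk0 : ∀ τ ∈ Ico s T, 0 ≤ k τ)
    (hle : ∀ τ ∈ Ioo s T, -k τ ≤ φ' τ) (hl : Tendsto φ (𝓝[<] T) (𝓝 l)) :
    φ s ≤ l + ∫ τ in s..T, k τ := by
  refine ge_of_tendsto (hl.add_const (∫ τ in s..T, k τ)) ?_
  filter_upwards [Ico_mem_nhdsLT hsT] with t ht
  have h1 := le_add_integral hc hd has ht.1 ht.2 (integrableOn_Icc_of_Ico hk le_rfl ht.2)
    fun τ hτ => hle τ ⟨hτ.1, hτ.2.trans ht.2⟩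
  have h2 := integral_le_tail hk hk0 le_rfl ht.1 ht.2.le
  linarith

lemma abs_sub_lim_le_tail {φ φ' k : ℝ → ℝ} {a T s l : ℝ} (hc : ContinuousOn φ (Ico a T))
    (hd : ∀ τ ∈ Ioo a T, HasDerivAt φ (φ' τ) τ) (has : a ≤ s) (hsT : s < T)
    (hk : IntegrableOn k (Ico s T)) (hle : ∀ τ ∈ Ioo s T, |φ' τ| ≤ k τ)
    (hk0 : ∀ τ ∈ Ico s T, 0 ≤ k τ)
    (hl : Tendsto φ (𝓝[<] T) (𝓝 l)) : |φ s - l| ≤ ∫ τ in s..T, k τ := by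
  rw [abs_le]
  constructor
  · have := le_lim_add_tail (φ := fun t => -φ t) (φ' := fun t => -φ' t) hc.neg
      (fun τ hτ => (hd τ hτ).neg) has hsT hk hk0
      (fun τ hτ => neg_le_neg ((le_abs_self _).trans (hle τ hτ))) hl.neg
    linarith
  · have := le_lim_add_tail hc hd has hsT hk hk0
      (fun τ hτ => neg_le_of_neg_le ((neg_le_abs _).trans (hle τ hτ))) hl
    linarith

/-- A bounded function whose derivative is bounded below by an integrable function has a limit. -/
lemma exists_lim_of_neg_le_deriv {φ φ' k : ℝ → ℝ} {a T B : ℝ} (haT : a < T)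
    (hc : ContinuousOn φ (Ico a T)) (hd : ∀ τ ∈ Ioo a T, HasDerivAt φ (φ' τ) τ)
    (hk : IntegrableOn k (Ico a T)) (hk0 : ∀ τ ∈ Ico a T, 0 ≤ k τ)
    (hle : ∀ τ ∈ Ioo a T, -k τ ≤ φ' τ) (hB : ∀ t ∈ Ico a T, φ t ≤ B) :
    ∃ l, Tendsto φ (𝓝[<] T) (𝓝 l) := by
  -- Subtracting the tail of `k` makes the function monotone; it keeps the upper bound because the
  -- tail is nonnegative, and the tail itself vanishes at `T`.
  have hm : MonotoneOn (fun t => φ t - ∫ τ in t..T, k τ) (Ioo a T) := by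
    intro s hs t ht hst
    have h1 := le_add_integral hc hd hs.1.le hst ht.2
      (integrableOn_Icc_of_Ico hk hs.1.le ht.2)
      fun τ hτ => hle τ ⟨hs.1.trans hτ.1, hτ.2.trans ht.2⟩
    have h2 := intervalIntegral.integral_add_adjacent_intervals
      (intervalIntegrable_of_Ico hk hs.1.le hst ht.2.le)
      (intervalIntegrable_of_Ico hk ht.1.le ht.2.le le_rfl)
    simp only
    linarith
  have hb : BddAbove ((fun t => φ t - ∫ τ in t..T, k τ) '' Ioo a T) := by
    refine ⟨B, ?_⟩
    rintro _ ⟨t, ht, rfl⟩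
    have := tail_nonneg hk0 ht.1.le ht.2.le
    have := hB t ⟨ht.1.le, ht.2⟩
    simp only
    linarith
  have h := (hm.tendsto_nhdsWithin_Ioo_left (nonempty_Ioo.2 haT) hb).add (tail_tendsto haT hk)
  exact ⟨_, by simpa using h⟩

lemma hasDerivAt_log_sub {T t : ℝ} (ht : t < T) :
    HasDerivAt (fun τ => Real.log (T - τ)) (-(T - t)⁻¹) t := by
  have := ((hasDerivAt_id' t).const_sub T).log (sub_pos.2 ht).ne'
  convert this using 1
  rw [neg_div, one_div]

/-- A function whose derivative is at least `η / (T - t)` up to an integrable error cannot be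
bounded above. -/
lemma false_of_log_growth {φ φ' k : ℝ → ℝ} {a T B η : ℝ} (haT : a < T) (hη : 0 < η)
    (hc : ContinuousOn φ (Ico a T)) (hd : ∀ τ ∈ Ioo a T, HasDerivAt φ (φ' τ) τ)
    (hk : IntegrableOn k (Ico a T)) (hk0 : ∀ τ ∈ Ico a T, 0 ≤ k τ)
    (hle : ∀ τ ∈ Ioo a T, η / (T - τ) - k τ ≤ φ' τ) (hB : ∀ t ∈ Ico a T, φ t ≤ B) : False := by
  have hlog : ContinuousOn (fun τ => Real.log (T - τ)) (Ico a T) := fun t ht =>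
    (hasDerivAt_log_sub ht.2).continuousAt.continuousWithinAt
  -- The sum `φ + η log (T - t)` has derivative at least `-k`, so boundedness of `φ` from above
  -- would bound `log (T - t)` from below.
  have key : ∀ t ∈ Ico a T, φ a + η * Real.log (T - a) - B - (∫ τ in a..T, k τ)
      ≤ η * Real.log (T - t) := by
    intro t ht
    have h1 := le_add_integral (φ := fun τ => φ τ + η * Real.log (T - τ))
      (φ' := fun τ => φ' τ + η * (-(T - τ)⁻¹)) (hc.add (hlog.const_smul η))
      (fun τ hτ => (hd τ hτ).add ((hasDerivAt_log_sub hτ.2).const_mul η)) le_rfl ht.1 ht.2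
      (integrableOn_Icc_of_Ico hk le_rfl ht.2) (fun τ hτ => by
        have := hle τ ⟨hτ.1, hτ.2.trans ht.2⟩
        rw [div_eq_mul_inv] at this
        linarith)
    have h2 := integral_le_tail hk hk0 le_rfl ht.1 ht.2.le
    have := hB t ht
    linarith
  have hlim : Tendsto (fun t => η * Real.log (T - t)) (𝓝[<] T) atBot := by
    refine Tendsto.const_mul_atBot hη (Real.tendsto_log_nhdsGT_zero.comp ?_)
    refine tendsto_nhdsWithin_iff.2 ⟨?_, ?_⟩
    · have : Tendsto (fun t => T - t) (𝓝 T) (𝓝 (T - T)) := tendsto_id.const_sub T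
      rw [sub_self] at this
      exact this.mono_left nhdsWithin_le_nhds
    · filter_upwards [self_mem_nhdsWithin] with t ht
      exact sub_pos.2 (mem_Iio.1 ht)
  obtain ⟨t, h1, h2⟩ := ((hlim.eventually_lt_atBot _).and (Ico_mem_nhdsLT haT)).exists
  exact absurd (key t h2) (not_le.2 h1)

/-- Backward estimate for an unstable mode. -/
lemma le_tail_of_unstable {u u' q : ℝ → ℝ} {a T B η C : ℝ} (hη : 0 < η) (hC : 0 ≤ C)
    (hc : ContinuousOn u (Ico a T)) (hd : ∀ τ ∈ Ioo a T, HasDerivAt u (u' τ) τ)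
    (hu0 : ∀ τ ∈ Ico a T, 0 ≤ u τ)
    (hq : IntegrableOn q (Ico a T)) (hq0 : ∀ τ ∈ Ico a T, 0 ≤ q τ)
    (hle : ∀ τ ∈ Ioo a T, η * u τ / (T - τ) - C * q τ ≤ u' τ) (hB : ∀ t ∈ Ico a T, u t ≤ B) :
    ∀ t ∈ Ico a T, u t ≤ C * ∫ τ in t..T, q τ := by
  intro t ht
  by_contra! hcon
  have hCq : IntegrableOn (fun τ => C * q τ) (Ico a T) := hq.const_mul C
  -- The excess over the claimed bound: since the drift is nonnegative, the forcing still to come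
  -- cannot bring `u` below `δ`. The drift is then at least `η δ / (T - τ)`, which forces
  -- logarithmic growth.
  set δ := u t - C * ∫ τ in t..T, q τ with hδ
  have hδ0 : 0 < δ := by rw [hδ]; linarith
  have hlow : ∀ s ∈ Ico t T, δ ≤ u s := by
    intro s hs
    have h1 := le_add_integral hc hd ht.1 hs.1 hs.2
      (integrableOn_Icc_of_Ico hCq ht.1 hs.2) (fun τ hτ => by
        have hτ' : τ ∈ Ioo a T := ⟨ht.1.trans_lt hτ.1, hτ.2.trans hs.2⟩
        have h2 := hle τ hτ'
        have h3 : 0 ≤ η * u τ / (T - τ) :=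
          div_nonneg (mul_nonneg hη.le (hu0 τ ⟨hτ'.1.le, hτ'.2⟩)) (by linarith [hτ'.2])
        linarith)
    have h2 := integral_le_tail hq hq0 ht.1 hs.1 hs.2.le
    rw [intervalIntegral.integral_const_mul] at h1
    have := mul_le_mul_of_nonneg_left h2 hC
    rw [hδ]; linarith
  have hsub : Ico t T ⊆ Ico a T := Ico_subset_Ico_left ht.1
  refine false_of_log_growth (k := fun τ => C * q τ) ht.2 (mul_pos hη hδ0) (hc.mono hsub)
    (fun τ hτ => hd τ ⟨ht.1.trans_lt hτ.1, hτ.2⟩) (hCq.mono_set hsub)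
    (fun τ hτ => mul_nonneg hC (hq0 τ (hsub hτ))) ?_ (fun s hs => hB s (hsub hs))
  intro τ hτ
  have h2 := hle τ ⟨ht.1.trans_lt hτ.1, hτ.2⟩
  have h3 : η * δ / (T - τ) ≤ η * u τ / (T - τ) := by
    have : 0 < T - τ := sub_pos.2 hτ.2
    gcongr
    exact hlow τ ⟨hτ.1.le, hτ.2⟩
  linarith

/-- Forward estimate for a stable mode. -/
lemma le_of_stable {u u' q : ℝ → ℝ} {a T η C : ℝ} (hη : 0 < η) (hC : 0 ≤ C)
    (hc : ContinuousOn u (Ico a T)) (hd : ∀ τ ∈ Ioo a T, HasDerivAt u (u' τ) τ)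
    (hq : IntegrableOn q (Ico a T)) (hq0 : ∀ τ ∈ Ico a T, 0 ≤ q τ)
    (hle : ∀ τ ∈ Ioo a T, u' τ ≤ -(η * u τ / (T - τ)) + C * q τ) {s t : ℝ} (has : a ≤ s)
    (hst : s ≤ t) (htT : t < T) :
    u t ≤ (T - t) ^ η * (T - s) ^ (-η) * u s + C * ∫ τ in s..T, q τ := by
  have hpow : ∀ τ < T, HasDerivAt (fun τ => (T - τ) ^ (-η)) (η * (T - τ) ^ (-η) / (T - τ)) τ := by
    intro τ hτ
    have hp : 0 < T - τ := sub_pos.2 hτ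
    have := ((hasDerivAt_id' τ).const_sub T).rpow_const (p := -η) (Or.inl hp.ne')
    convert this using 1
    rw [Real.rpow_sub_one hp.ne']
    ring
  have hTt : 0 < T - t := sub_pos.2 htT
  -- The integrating factor `(T - τ) ^ (-η)` increases in `τ`, so on the forcing term it is replaced
  -- by its value at the right end `t`; the final multiplication by `(T - t) ^ η` cancels it.
  set D := C * (T - t) ^ (-η) with hD
  have hDq : IntegrableOn (fun τ => D * q τ) (Ico a T) := hq.const_mul D
  have h1 := le_add_integral (φ := fun τ => -(u τ * (T - τ) ^ (-η)))
      (φ' := fun τ => -(u' τ * (T - τ) ^ (-η) + u τ * (η * (T - τ) ^ (-η) / (T - τ))))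
      (hc.mul (fun τ hτ => (hpow τ hτ.2).continuousAt.continuousWithinAt)).neg
      (fun τ hτ => ((hd τ hτ).mul (hpow τ hτ.2)).neg) has hst htT
      (integrableOn_Icc_of_Ico hDq has htT) (fun τ hτ => by
        have hτ' : τ ∈ Ioo a T := ⟨has.trans_lt hτ.1, hτ.2.trans htT⟩
        have h2 := hle τ hτ'
        have hp : 0 < T - τ := sub_pos.2 hτ'.2
        have h3 : (T - τ) ^ (-η) ≤ (T - t) ^ (-η) :=
          Real.rpow_le_rpow_of_nonpos hTt (by linarith [hτ.2]) (by linarith)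
        have h4 : 0 ≤ (T - τ) ^ (-η) := (Real.rpow_pos_of_pos hp _).le
        have h5 := mul_le_mul_of_nonneg_right h2 h4
        have h6 := mul_le_mul_of_nonneg_left h3
          (mul_nonneg hC (hq0 τ ⟨hτ'.1.le, hτ'.2⟩))
        have h7 : (-(η * u τ / (T - τ)) + C * q τ) * (T - τ) ^ (-η)
          = -(u τ * (η * (T - τ) ^ (-η) / (T - τ))) + C * q τ * (T - τ) ^ (-η) := by ring
        have h8 : D * q τ = C * q τ * (T - t) ^ (-η) := by rw [hD]; ring
        linarith)
  have h2 := mul_le_mul_of_nonneg_left (integral_le_tail hq hq0 has hst htT.le) hC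
  rw [intervalIntegral.integral_const_mul] at h1
  have hP : 0 < (T - t) ^ η := Real.rpow_pos_of_pos hTt _
  have hPP : (T - t) ^ η * (T - t) ^ (-η) = 1 := by
    rw [← Real.rpow_add hTt]; simp
  have h3 : u t * (T - t) ^ (-η) ≤ u s * (T - s) ^ (-η) + D * ∫ τ in s..t, q τ := by
    linarith
  have h4 := mul_le_mul_of_nonneg_left h3 hP.le
  have h5 : (T - t) ^ η * (u t * (T - t) ^ (-η)) = u t := by
    rw [mul_left_comm, hPP, mul_one]
  have h6 : (T - t) ^ η * (u s * (T - s) ^ (-η) + D * ∫ τ in s..t, q τ)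
      = (T - t) ^ η * (T - s) ^ (-η) * u s + C * ∫ τ in s..t, q τ := by
    rw [hD, mul_add]
    congr 1
    · ring
    · calc _ = C * ((T - t) ^ η * (T - t) ^ (-η)) * ∫ τ in s..t, q τ := by ring
        _ = _ := by rw [hPP, mul_one]
  linarith

lemma exists_Ico_of_eventually {p : ℝ → Prop} {a T : ℝ} (haT : a < T)
    (h : ∀ᶠ t in 𝓝[<] T, p t) : ∃ b ∈ Ico a T, ∀ t ∈ Ico b T, p t := by
  obtain ⟨l, hl, hlp⟩ := mem_nhdsLT_iff_exists_Ico_subset.1 h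
  exact ⟨max a l, ⟨le_max_left _ _, max_lt haT hl⟩,
    fun t ht => hlp ⟨(le_max_right _ _).trans ht.1, ht.2⟩⟩

/-! ### The flow on the sphere in eigencoordinates. -/

section Modal

variable {ι : Type*} [Fintype ι]

/-- The Rayleigh quotient of a unit vector in eigencoordinates. -/
def rayleigh (μ : ι → ℝ) (c : ι → ℝ → ℝ) (t : ℝ) : ℝ := ∑ i, μ i * c i t ^ 2

open Classical in
/-- The squared norm of the part of a vector transverse to the eigenspace for `Λ`, in
eigencoordinates. -/
noncomputable def transverse (μ : ι → ℝ) (c : ι → ℝ → ℝ) (Λ t : ℝ) : ℝ :=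
  ∑ i, if μ i = Λ then 0 else c i t ^ 2

/-- The perturbed flow on the unit sphere in eigencoordinates, with coefficients singular
at `T`. -/
structure ModalFlow (μ : ι → ℝ) (c F : ι → ℝ → ℝ) (h e : ℝ → ℝ) (a T m M : ℝ) : Prop where
  lt : a < T
  m_pos : 0 < m
  M_pos : 0 < M
  cont : ∀ i, ContinuousOn (c i) (Ico a T)
  sum_sq : ∀ t ∈ Ico a T, ∑ i, c i t ^ 2 = 1
  deriv : ∀ i, ∀ t ∈ Ioo a T,
    HasDerivAt (c i) (h t * (μ i - rayleigh μ c t) * c i t + F i t) t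
  le_coeff : ∀ t ∈ Ioo a T, m / (T - t) ≤ h t
  coeff_le : ∀ t ∈ Ioo a T, h t ≤ M / (T - t)
  force : ∀ i, ∀ t ∈ Ioo a T, |F i t| ≤ M * (e t / (T - t))
  nonneg : ∀ t ∈ Ico a T, 0 ≤ e t
  int : IntegrableOn (fun τ => e τ / (T - τ)) (Ico a T)

lemma transverse_nonneg (μ : ι → ℝ) (c : ι → ℝ → ℝ) (Λ t : ℝ) : 0 ≤ transverse μ c Λ t :=
  Finset.sum_nonneg fun i _ => by split_ifs <;> positivity

namespace ModalFlow

variable {μ : ι → ℝ} {c F : ι → ℝ → ℝ} {h e : ℝ → ℝ} {a T m M Λ : ℝ}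

lemma restrict (X : ModalFlow μ c F h e a T m M) {b : ℝ} (hb : b ∈ Ico a T) :
    ModalFlow μ c F h e b T m M where
  lt := hb.2
  m_pos := X.m_pos
  M_pos := X.M_pos
  cont i := (X.cont i).mono (Ico_subset_Ico_left hb.1)
  sum_sq t ht := X.sum_sq t (Ico_subset_Ico_left hb.1 ht)
  deriv i t ht := X.deriv i t (Ioo_subset_Ioo_left hb.1 ht)
  le_coeff t ht := X.le_coeff t (Ioo_subset_Ioo_left hb.1 ht)
  coeff_le t ht := X.coeff_le t (Ioo_subset_Ioo_left hb.1 ht)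
  force i t ht := X.force i t (Ioo_subset_Ioo_left hb.1 ht)
  nonneg t ht := X.nonneg t (Ico_subset_Ico_left hb.1 ht)
  int := X.int.mono_set (Ico_subset_Ico_left hb.1)

lemma sq_le_one (X : ModalFlow μ c F h e a T m M) (i : ι) {t : ℝ} (ht : t ∈ Ico a T) :
    c i t ^ 2 ≤ 1 := by
  rw [← X.sum_sq t ht]
  exact Finset.single_le_sum (f := fun i => c i t ^ 2) (fun i _ => sq_nonneg _)
    (Finset.mem_univ i)

lemma abs_le_one (X : ModalFlow μ c F h e a T m M) (i : ι) {t : ℝ} (ht : t ∈ Ico a T) :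
    |c i t| ≤ 1 := (sq_le_one_iff_abs_le_one _).1 (X.sq_le_one i ht)

lemma drive_nonneg (X : ModalFlow μ c F h e a T m M) {t : ℝ} (ht : t ∈ Ico a T) :
    0 ≤ e t / (T - t) := div_nonneg (X.nonneg t ht) (sub_pos.2 ht.2).le

lemma rayleigh_cont (X : ModalFlow μ c F h e a T m M) :
    ContinuousOn (rayleigh μ c) (Ico a T) :=
  continuousOn_finsetSum _ fun i _ => continuousOn_const.mul ((X.cont i).pow 2)

lemma transverse_cont (X : ModalFlow μ c F h e a T m M) :
    ContinuousOn (transverse μ c Λ) (Ico a T) := by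
  refine continuousOn_finsetSum _ fun i _ => ?_
  split_ifs
  · exact continuousOn_const
  · exact (X.cont i).pow 2

/-- As the weights `c_i ^ 2` sum to one, `λ - Λ` is the weighted mean of `μ_i - Λ`, to which neutral
modes contribute nothing. The deviation is therefore quadratic in the transverse part. -/
lemma abs_rayleigh_sub_le (X : ModalFlow μ c F h e a T m M) {t : ℝ} (ht : t ∈ Ico a T) :
    |rayleigh μ c t - Λ| ≤ (∑ i, |μ i - Λ|) * transverse μ c Λ t := by
  have h1 : rayleigh μ c t - Λ = ∑ i, (μ i - Λ) * c i t ^ 2 := by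
    simp only [sub_mul, Finset.sum_sub_distrib, ← Finset.mul_sum, X.sum_sq t ht, rayleigh,
      mul_one]
  rw [h1, Finset.sum_mul]
  refine (Finset.abs_sum_le_sum_abs _ _).trans (Finset.sum_le_sum fun i _ => ?_)
  rw [abs_mul]
  by_cases hi : μ i = Λ
  · simp [hi]
  · rw [abs_of_nonneg (sq_nonneg (c i t))]
    refine mul_le_mul_of_nonneg_left ?_ (abs_nonneg _)
    have := Finset.single_le_sum (f := fun i => if μ i = Λ then 0 else c i t ^ 2)
      (fun i _ => by split_ifs <;> positivity) (Finset.mem_univ i)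
    simp only [hi, if_false] at this
    unfold transverse
    convert this

lemma rayleigh_le (X : ModalFlow μ c F h e a T m M) {t : ℝ} (ht : t ∈ Ico a T) :
    rayleigh μ c t ≤ ∑ i, |μ i| :=
  Finset.sum_le_sum fun i _ => by
    have h1 := X.sq_le_one i ht
    nlinarith [le_abs_self (μ i), sq_nonneg (c i t), abs_nonneg (μ i)]

/-- Replacing one factor `μ_i` by `μ_i - λ` costs nothing, since `λ` is the mean of the `μ_i`. This
turns the main term into a variance, which is nonnegative. -/
lemma rayleigh_deriv (X : ModalFlow μ c F h e a T m M) {t : ℝ} (ht : t ∈ Ioo a T) :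
    HasDerivAt (rayleigh μ c) (2 * h t * (∑ i, (μ i - rayleigh μ c t) ^ 2 * c i t ^ 2)
      + ∑ i, 2 * μ i * c i t * F i t) t := by
  have h1 : HasDerivAt (rayleigh μ c) (∑ i, μ i * (2 * c i t *
      (h t * (μ i - rayleigh μ c t) * c i t + F i t))) t := by
    refine HasDerivAt.fun_sum fun i _ => HasDerivAt.const_mul _ ?_
    have := (X.deriv i t ht).fun_pow 2
    simpa using this
  convert h1 using 1
  have h2 : ∑ i, (μ i - rayleigh μ c t) * c i t ^ 2 = 0 := by
    simp only [sub_mul, Finset.sum_sub_distrib, ← Finset.mul_sum, X.sum_sq t ⟨ht.1.le, ht.2⟩,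
      rayleigh, mul_one, sub_self]
  have h3 : ∑ i, μ i * (2 * c i t * (h t * (μ i - rayleigh μ c t) * c i t + F i t))
      = 2 * h t * (∑ i, (μ i - rayleigh μ c t) ^ 2 * c i t ^ 2)
        + (∑ i, 2 * μ i * c i t * F i t)
        + 2 * h t * rayleigh μ c t * ∑ i, (μ i - rayleigh μ c t) * c i t ^ 2 := by
    rw [Finset.mul_sum, Finset.mul_sum, ← Finset.sum_add_distrib, ← Finset.sum_add_distrib]
    refine Finset.sum_congr rfl fun i _ => ?_
    ring
  rw [h3, h2, mul_zero, add_zero]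

lemma abs_rayleigh_force_le (X : ModalFlow μ c F h e a T m M) {t : ℝ} (ht : t ∈ Ioo a T) :
    |∑ i, 2 * μ i * c i t * F i t| ≤ (∑ i, 2 * |μ i| * M) * (e t / (T - t)) := by
  rw [Finset.sum_mul]
  refine (Finset.abs_sum_le_sum_abs _ _).trans (Finset.sum_le_sum fun i _ => ?_)
  rw [abs_mul, abs_mul, abs_mul, abs_two]
  calc 2 * |μ i| * |c i t| * |F i t| ≤ 2 * |μ i| * 1 * (M * (e t / (T - t))) := by
        gcongr
        · exact X.abs_le_one i ⟨ht.1.le, ht.2⟩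
        · exact X.force i t ht
    _ = _ := by ring

lemma coeff_pos (X : ModalFlow μ c F h e a T m M) {t : ℝ} (ht : t ∈ Ioo a T) : 0 < h t :=
  (div_pos X.m_pos (sub_pos.2 ht.2)).trans_le (X.le_coeff t ht)

lemma neg_le_rayleigh_deriv (X : ModalFlow μ c F h e a T m M) {t : ℝ} (ht : t ∈ Ioo a T) :
    -((∑ i, 2 * |μ i| * M) * (e t / (T - t))) ≤
      2 * h t * (∑ i, (μ i - rayleigh μ c t) ^ 2 * c i t ^ 2) + ∑ i, 2 * μ i * c i t * F i t := by
  have h1 := neg_le_of_abs_le (X.abs_rayleigh_force_le ht)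
  have h2 : 0 ≤ 2 * h t * (∑ i, (μ i - rayleigh μ c t) ^ 2 * c i t ^ 2) :=
    mul_nonneg (by linarith [X.coeff_pos ht]) (Finset.sum_nonneg fun i _ => by positivity)
  linarith

lemma rayleigh_error_nonneg (X : ModalFlow μ c F h e a T m M) :
    0 ≤ ∑ i, 2 * |μ i| * M :=
  Finset.sum_nonneg fun i _ => mul_nonneg (by positivity) X.M_pos.le

/-- The quotient is bounded above and, apart from an integrable error, increasing. -/
lemma exists_rayleigh_lim (X : ModalFlow μ c F h e a T m M) :
    ∃ Λ, Tendsto (rayleigh μ c) (𝓝[<] T) (𝓝 Λ) :=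
  exists_lim_of_neg_le_deriv X.lt X.rayleigh_cont (fun _ ht => X.rayleigh_deriv ht)
    (X.int.const_mul _)
    (fun _ ht => mul_nonneg X.rayleigh_error_nonneg (X.drive_nonneg ht))
    (fun _ ht => X.neg_le_rayleigh_deriv ht) (fun _ ht => X.rayleigh_le ht)

/-- Near `T` the Rayleigh quotient stays away from every eigenvalue other than its limit. -/
lemma exists_gap (X : ModalFlow μ c F h e a T m M)
    (hΛ : Tendsto (rayleigh μ c) (𝓝[<] T) (𝓝 Λ)) :
    ∃ δ > 0, ∃ b ∈ Ico a T, ∀ t ∈ Ico b T, ∀ i,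
      (μ i < Λ → μ i - rayleigh μ c t ≤ -δ) ∧ (Λ < μ i → δ ≤ μ i - rayleigh μ c t) := by
  -- Half of the distance `2 * δ` to the other eigenvalues is reserved for the deviation of the
  -- quotient from `Λ`. Choosing `δ` small, rather than as a minimum, also covers the case where
  -- every `μ i` equals `Λ`.
  have hδ : ∃ δ > 0, ∀ i, μ i ≠ Λ → 2 * δ ≤ |μ i - Λ| := by
    have h1 : ∀ i, ∀ᶠ δ in 𝓝[>] (0 : ℝ), μ i ≠ Λ → 2 * δ ≤ |μ i - Λ| := by
      intro i
      by_cases hi : μ i = Λ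
      · simp [hi]
      · have hp : 0 < |μ i - Λ| / 2 := half_pos (abs_pos.2 (sub_ne_zero.2 hi))
        filter_upwards [Ioo_mem_nhdsGT hp] with δ hδ _
        linarith [hδ.2]
    obtain ⟨δ, h2, h3⟩ := ((eventually_all.2 h1).and self_mem_nhdsWithin).exists
    exact ⟨δ, h3, h2⟩
  obtain ⟨δ, hδ0, hδ⟩ := hδ
  obtain ⟨b, hb, hbt⟩ := exists_Ico_of_eventually X.lt
    (hΛ.eventually (Metric.closedBall_mem_nhds Λ hδ0))
  refine ⟨δ, hδ0, b, hb, fun t ht i => ?_⟩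
  have h1 : |rayleigh μ c t - Λ| ≤ δ := hbt t ht
  rw [abs_le] at h1
  constructor
  · intro hi
    have := hδ i hi.ne
    rw [abs_of_neg (sub_neg.2 hi)] at this
    linarith
  · intro hi
    have := hδ i hi.ne'
    rw [abs_of_pos (sub_pos.2 hi)] at this
    linarith

lemma gap_sq_mul_transverse_le {δ t : ℝ} (hδ0 : 0 < δ)
    (hδ : ∀ i, (μ i < Λ → μ i - rayleigh μ c t ≤ -δ) ∧ (Λ < μ i → δ ≤ μ i - rayleigh μ c t)) :
    δ ^ 2 * transverse μ c Λ t ≤ ∑ i, (μ i - rayleigh μ c t) ^ 2 * c i t ^ 2 := by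
  rw [transverse, Finset.mul_sum]
  refine Finset.sum_le_sum fun i _ => ?_
  split_ifs with hi
  · simp only [mul_zero]; positivity
  · refine mul_le_mul_of_nonneg_right ?_ (sq_nonneg _)
    rcases lt_or_gt_of_ne hi with h1 | h1
    · nlinarith [(hδ i).1 h1]
    · nlinarith [(hδ i).2 h1]

/-- If no `μ i` equals the limit, the whole unit vector is transverse and the variance is at least
`δ ^ 2`. The quotient then grows at rate `2 m δ ^ 2 / (T - t)` up to an integrable error,
contradicting its boundedness. -/
lemma lim_mem_range (X : ModalFlow μ c F h e a T m M)
    (hΛ : Tendsto (rayleigh μ c) (𝓝[<] T) (𝓝 Λ)) : ∃ i, μ i = Λ := by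
  by_contra! hne
  obtain ⟨δ, hδ0, b, hb, hδ⟩ := X.exists_gap hΛ
  have Y := X.restrict hb
  refine false_of_log_growth (η := 2 * m * δ ^ 2) Y.lt (by have := X.m_pos; positivity)
    Y.rayleigh_cont (fun _ ht => Y.rayleigh_deriv ht) (Y.int.const_mul _)
    (fun _ ht => mul_nonneg Y.rayleigh_error_nonneg (Y.drive_nonneg ht))
    (fun t ht => ?_) (fun _ ht => Y.rayleigh_le ht)
  have ht' : t ∈ Ico b T := ⟨ht.1.le, ht.2⟩
  have h1 := gap_sq_mul_transverse_le hδ0 (hδ t ht')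
  have h2 : transverse μ c Λ t = 1 := by
    rw [← Y.sum_sq t ht']
    exact Finset.sum_congr rfl fun i _ => by simp [hne i]
  rw [h2, mul_one] at h1
  have h3 := neg_le_of_abs_le (Y.abs_rayleigh_force_le ht)
  have h4 : 2 * (m / (T - t)) * δ ^ 2 ≤
      2 * h t * (∑ i, (μ i - rayleigh μ c t) ^ 2 * c i t ^ 2) := by
    have := Y.coeff_pos ht
    have := Y.le_coeff t ht
    gcongr
  have h5 : 2 * m * δ ^ 2 / (T - t) = 2 * (m / (T - t)) * δ ^ 2 := by ring
  rw [h5]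
  linarith

/-! ### Decay of the transverse modes and convergence of the neutral ones. -/

lemma sq_deriv (X : ModalFlow μ c F h e a T m M) (i : ι) {t : ℝ} (ht : t ∈ Ioo a T) :
    HasDerivAt (fun t => c i t ^ 2)
      (2 * h t * (μ i - rayleigh μ c t) * c i t ^ 2 + 2 * c i t * F i t) t := by
  refine ((X.deriv i t ht).fun_pow 2).congr_deriv ?_
  simp only [Nat.cast_ofNat, Nat.add_one_sub_one, pow_one]
  ring

/-- Young's inequality with weight `m * δ`: the first term consumes half of the drift `2 m δ c_i ^ 2
/ (T - t)` guaranteed by the spectral gap. The price is the square of `e`, which is the source of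
`E2`. -/
lemma abs_sq_force_le (X : ModalFlow μ c F h e a T m M) (i : ι) {δ : ℝ} (hδ : 0 < δ) {t : ℝ}
    (ht : t ∈ Ioo a T) :
    |2 * c i t * F i t| ≤ m * δ * c i t ^ 2 / (T - t)
      + M ^ 2 / (m * δ) * ((T - t)⁻¹ * e t ^ 2) := by
  have hp : 0 < T - t := sub_pos.2 ht.2
  have hmδ : 0 < m * δ := mul_pos X.m_pos hδ
  have h1 : |2 * c i t * F i t| ≤ 2 * |c i t| * (M * (e t / (T - t))) := by
    rw [abs_mul, abs_mul, abs_two]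
    exact mul_le_mul_of_nonneg_left (X.force i t ht) (by positivity)
  refine h1.trans ?_
  have h2 : m * δ * c i t ^ 2 / (T - t) + M ^ 2 / (m * δ) * ((T - t)⁻¹ * e t ^ 2)
      - 2 * |c i t| * (M * (e t / (T - t)))
      = (m * δ * |c i t| - M * e t) ^ 2 / (m * δ * (T - t)) := by
    rw [← sq_abs (c i t)]
    have := X.m_pos
    field_simp
    ring
  have h3 : 0 ≤ (m * δ * |c i t| - M * e t) ^ 2 / (m * δ * (T - t)) := by positivity
  linarith

/-- Estimates of the modes transverse to the limiting eigenspace. -/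
lemma exists_mode_bounds (X : ModalFlow μ c F h e a T m M)
    (hΛ : Tendsto (rayleigh μ c) (𝓝[<] T) (𝓝 Λ))
    (hq : IntegrableOn (fun τ => (T - τ)⁻¹ * e τ ^ 2) (Ico a T)) :
    ∃ η > (0 : ℝ), ∃ C ≥ (0 : ℝ), ∃ b ∈ Ico a T, ∀ i,
      (Λ < μ i → ∀ t ∈ Ico b T, c i t ^ 2 ≤ C * ∫ τ in t..T, (T - τ)⁻¹ * e τ ^ 2) ∧
      (μ i < Λ → ∀ s t, b ≤ s → s ≤ t → t < T → c i t ^ 2 ≤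
        (T - t) ^ η * (T - s) ^ (-η) + C * ∫ τ in s..T, (T - τ)⁻¹ * e τ ^ 2) := by
  obtain ⟨δ, hδ0, b, hb, hδ⟩ := X.exists_gap hΛ
  have Y := X.restrict hb
  have hmδ : 0 < m * δ := mul_pos X.m_pos hδ0
  have hM := X.M_pos
  have hq' := hq.mono_set (Ico_subset_Ico_left hb.1)
  have hq0 : ∀ τ ∈ Ico b T, 0 ≤ (T - τ)⁻¹ * e τ ^ 2 := fun τ hτ =>
    mul_nonneg (inv_nonneg.2 (sub_pos.2 hτ.2).le) (sq_nonneg _)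
  -- The exponent is the half of the drift `2 * m * δ` left after Young's inequality.
  refine ⟨m * δ, hmδ, M ^ 2 / (m * δ), by positivity, b, hb, fun i => ⟨fun hi => ?_, fun hi => ?_⟩⟩
  · refine le_tail_of_unstable hmδ (by positivity) ((Y.cont i).pow 2)
      (fun _ ht => Y.sq_deriv i ht) (fun _ _ => sq_nonneg _) hq' hq0 (fun t ht => ?_)
      (fun _ ht => Y.sq_le_one i ht)
    have h1 := neg_le_of_abs_le (Y.abs_sq_force_le i hδ0 ht)
    have h2 : 2 * (m / (T - t)) * δ * c i t ^ 2 ≤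
        2 * h t * (μ i - rayleigh μ c t) * c i t ^ 2 := by
      have := Y.coeff_pos ht
      have := Y.le_coeff t ht
      have := (hδ t ⟨ht.1.le, ht.2⟩ i).2 hi
      gcongr
    have h3 : 2 * (m / (T - t)) * δ * c i t ^ 2 = 2 * (m * δ * c i t ^ 2 / (T - t)) := by ring
    linarith
  · intro s t hs hst ht
    have h0 := le_of_stable (u := fun t => c i t ^ 2) (C := M ^ 2 / (m * δ)) hmδ
      (by positivity) ((Y.cont i).pow 2) (fun _ ht => Y.sq_deriv i ht) hq' hq0
      (fun t ht => by
        have h1 := le_of_abs_le (Y.abs_sq_force_le i hδ0 ht)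
        have h2 : 2 * (m / (T - t)) * δ * c i t ^ 2 ≤
            2 * h t * (-(μ i - rayleigh μ c t)) * c i t ^ 2 := by
          have := Y.coeff_pos ht
          have := Y.le_coeff t ht
          have := (hδ t ⟨ht.1.le, ht.2⟩ i).1 hi
          gcongr
          linarith
        have h3 : 2 * (m / (T - t)) * δ * c i t ^ 2 = 2 * (m * δ * c i t ^ 2 / (T - t)) := by
          ring
        linarith) hs hst ht
    refine h0.trans (add_le_add_left ?_ _)
    refine mul_le_of_le_one_right ?_ (Y.sq_le_one i ⟨hs, hst.trans_lt ht⟩)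
    exact mul_nonneg (Real.rpow_nonneg (by linarith) _) (Real.rpow_nonneg (by linarith) _)

/-- Estimates of the transverse part. -/
lemma exists_transverse_bounds (X : ModalFlow μ c F h e a T m M)
    (hΛ : Tendsto (rayleigh μ c) (𝓝[<] T) (𝓝 Λ))
    (hq : IntegrableOn (fun τ => (T - τ)⁻¹ * e τ ^ 2) (Ico a T)) :
    ∃ η > (0 : ℝ), ∃ C ≥ (0 : ℝ), ∃ b ∈ Ico a T,
      ((∀ i, Λ ≤ μ i) → ∀ t ∈ Ico b T,
        transverse μ c Λ t ≤ C * ∫ τ in t..T, (T - τ)⁻¹ * e τ ^ 2) ∧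
      (∀ s t, b ≤ s → s ≤ t → t < T → transverse μ c Λ t ≤
        C * ((T - t) ^ η * (T - s) ^ (-η) + ∫ τ in s..T, (T - τ)⁻¹ * e τ ^ 2)) := by
  obtain ⟨η, hη, C, hC, b, hb, hbd⟩ := X.exists_mode_bounds hΛ hq
  have hq0 : ∀ τ ∈ Ico a T, 0 ≤ (T - τ)⁻¹ * e τ ^ 2 := fun τ hτ =>
    mul_nonneg (inv_nonneg.2 (sub_pos.2 hτ.2).le) (sq_nonneg _)
  -- One copy of `1 + C` per mode: the `1` pays for the initial value of a stable mode, the `C` for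
  -- the forcing.
  refine ⟨η, hη, ∑ _i : ι, (1 + C), Finset.sum_nonneg fun _ _ => by positivity, b, hb, ?_, ?_⟩
  · intro hmin t ht
    have hQ := tail_nonneg hq0 (hb.1.trans ht.1) ht.2.le
    rw [Finset.sum_mul, transverse]
    refine Finset.sum_le_sum fun i _ => ?_
    split_ifs with hi
    · positivity
    · have := (hbd i).1 (lt_of_le_of_ne (hmin i) (Ne.symm hi)) t ht
      nlinarith
  · intro s t hs hst ht
    have hQ := tail_nonneg hq0 (hb.1.trans hs) (hst.trans ht.le)
    have hP : 0 ≤ (T - t) ^ η * (T - s) ^ (-η) :=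
      mul_nonneg (Real.rpow_nonneg (by linarith) _) (Real.rpow_nonneg (by linarith) _)
    rw [Finset.sum_mul, transverse]
    refine Finset.sum_le_sum fun i _ => ?_
    split_ifs with hi
    · positivity
    · rcases lt_or_gt_of_ne hi with h1 | h1
      · have := (hbd i).2 h1 s t hs hst ht
        nlinarith
      · have h2 := (hbd i).1 h1 t ⟨hs.trans hst, ht⟩
        have h3 := mul_le_mul_of_nonneg_left (tail_anti hq hq0 (hb.1.trans hs) hst ht.le) hC
        nlinarith

/-- The transverse part is square integrable against `(T - τ)⁻¹`, with a quantitative bound. -/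
lemma exists_transverse_integrable (X : ModalFlow μ c F h e a T m M)
    (hΛ : Tendsto (rayleigh μ c) (𝓝[<] T) (𝓝 Λ)) :
    ∃ C ≥ (0 : ℝ), ∃ b ∈ Ico a T,
      IntegrableOn (fun τ => transverse μ c Λ τ / (T - τ)) (Ico b T) ∧
      ∀ t ∈ Ico b T, ∫ τ in t..T, transverse μ c Λ τ / (T - τ) ≤
        C * (transverse μ c Λ t + ∫ τ in t..T, e τ / (T - τ)) := by
  obtain ⟨δ, hδ0, b, hb, hδ⟩ := X.exists_gap hΛ
  have Y := X.restrict hb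
  have hm := X.m_pos
  set κ := 2 * m * δ ^ 2 with hκ
  have hκ0 : 0 < κ := by positivity
  set K := ∑ i, 2 * |μ i| * M with hK
  have hK0 : 0 ≤ K := X.rayleigh_error_nonneg
  set D := ∑ i, |μ i - Λ| with hD
  have hD0 : 0 ≤ D := Finset.sum_nonneg fun _ _ => abs_nonneg _
  have hcont : ContinuousOn (fun τ => transverse μ c Λ τ / (T - τ)) (Ico b T) :=
    Y.transverse_cont.div (continuousOn_const.sub continuousOn_id)
      fun t ht => (sub_pos.2 ht.2).ne'
  have hintIcc : ∀ s t, b ≤ s → t < T →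
      IntegrableOn (fun τ => transverse μ c Λ τ / (T - τ)) (Icc s t) := fun s t hs ht =>
    (hcont.mono fun x hx => ⟨hs.trans hx.1, hx.2.trans_lt ht⟩).integrableOn_Icc
  have hW0 : ∀ τ ∈ Ico b T, 0 ≤ transverse μ c Λ τ / (T - τ) := fun τ hτ =>
    div_nonneg (transverse_nonneg _ _ _ _) (sub_pos.2 hτ.2).le
  have hE0 : ∀ τ ∈ Ico b T, 0 ≤ e τ / (T - τ) := fun τ hτ => Y.drive_nonneg hτ
  -- Integrate `λ' ≥ κ W / (T - τ) - K e / (T - τ)`, with `W` the transverse part: the gain in the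
  -- quotient controls the weighted integral of `W`.
  have key : ∀ s t, b ≤ s → s ≤ t → t < T → κ * ∫ τ in s..t, transverse μ c Λ τ / (T - τ) ≤
      rayleigh μ c t - rayleigh μ c s + K * ∫ τ in s..T, e τ / (T - τ) := by
    intro s t hs hst ht
    have h1 := le_add_integral (k := fun τ => K * (e τ / (T - τ))
        - κ * (transverse μ c Λ τ / (T - τ)))
      Y.rayleigh_cont (fun _ ht => Y.rayleigh_deriv ht) hs hst ht
      (((integrableOn_Icc_of_Ico Y.int hs ht).const_mul K).sub ((hintIcc s t hs ht).const_mul κ))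
      (fun τ hτ => by
        have hτ' : τ ∈ Ioo b T := ⟨hs.trans_lt hτ.1, hτ.2.trans ht⟩
        have h2 := neg_le_of_abs_le (Y.abs_rayleigh_force_le hτ')
        have h3 := gap_sq_mul_transverse_le hδ0 (hδ τ ⟨hτ'.1.le, hτ'.2⟩)
        have h4 : 2 * (m / (T - τ)) * (δ ^ 2 * transverse μ c Λ τ) ≤
            2 * h τ * (∑ i, (μ i - rayleigh μ c τ) ^ 2 * c i τ ^ 2) := by
          have := Y.coeff_pos hτ'
          have := Y.le_coeff τ hτ'
          have := transverse_nonneg μ c Λ τ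
          gcongr
        have h5 : κ * (transverse μ c Λ τ / (T - τ))
          = 2 * (m / (T - τ)) * (δ ^ 2 * transverse μ c Λ τ) := by rw [hκ]; ring
        linarith)
    rw [intervalIntegral.integral_sub
      ((intervalIntegrable_of_Ico Y.int hs hst ht.le).const_mul K)
      (((intervalIntegrable_iff_integrableOn_Icc_of_le hst).2 (hintIcc s t hs ht)).const_mul κ),
      intervalIntegral.integral_const_mul, intervalIntegral.integral_const_mul] at h1
    have h2 := mul_le_mul_of_nonneg_left (integral_le_tail Y.int hE0 hs hst ht.le) hK0
    linarith
  -- The partial integrals are uniformly bounded because the quotient is.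
  have hint : IntegrableOn (fun τ => transverse μ c Λ τ / (T - τ)) (Ico b T) := by
    rw [← integrableOn_Icc_iff_integrableOn_Ico, integrableOn_Icc_iff_integrableOn_Ioc]
    obtain ⟨x, hx, hxT, hlim⟩ := exists_seq_strictMono_tendsto' Y.lt
    refine integrableOn_Ioc_of_intervalIntegral_norm_bounded_right
      (I := κ⁻¹ * ((∑ i, |μ i|) - rayleigh μ c b + K * ∫ τ in b..T, e τ / (T - τ)))
      (fun i => (hintIcc b (x i) le_rfl (hxT i).2).mono_set Ioc_subset_Icc_self) hlim
      (Eventually.of_forall fun i => ?_)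
    rw [le_inv_mul_iff₀ hκ0]
    have h1 := key b (x i) le_rfl (hxT i).1.le (hxT i).2
    have h2 := Y.rayleigh_le ⟨(hxT i).1.le, (hxT i).2⟩
    have h3 : ∫ τ in Ioc b (x i), ‖transverse μ c Λ τ / (T - τ)‖
        = ∫ τ in b..(x i), transverse μ c Λ τ / (T - τ) := by
      rw [intervalIntegral.integral_of_le (hxT i).1.le]
      refine setIntegral_congr_fun measurableSet_Ioc fun τ hτ => ?_
      exact Real.norm_of_nonneg (hW0 τ ⟨hτ.1.le, hτ.2.trans_lt (hxT i).2⟩)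
    rw [h3]
    linarith
  refine ⟨κ⁻¹ * (D + K), by positivity, b, hb, hint, fun t ht => ?_⟩
  -- With the upper limit sent to `T`, the gain becomes `Λ - λ(t)`, which is at most a multiple of
  -- `W(t)`; this closes the quantitative bound.
  have h1 : κ * ∫ τ in t..T, transverse μ c Λ τ / (T - τ) ≤
      Λ - rayleigh μ c t + K * ∫ τ in t..T, e τ / (T - τ) := by
    have hl1 : Tendsto (fun s => κ * ∫ τ in t..s, transverse μ c Λ τ / (T - τ)) (𝓝[<] T)
        (𝓝 (κ * ∫ τ in t..T, transverse μ c Λ τ / (T - τ))) := by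
      refine Tendsto.const_mul κ ?_
      have h2 := (tail_tendsto Y.lt hint).const_sub
        (∫ τ in t..T, transverse μ c Λ τ / (T - τ))
      rw [sub_zero] at h2
      refine h2.congr' ?_
      filter_upwards [Ico_mem_nhdsLT ht.2] with s hs
      rw [sub_eq_iff_eq_add]
      exact (intervalIntegral.integral_add_adjacent_intervals
        (intervalIntegrable_of_Ico hint ht.1 hs.1 hs.2.le)
        (intervalIntegrable_of_Ico hint (ht.1.trans hs.1) hs.2.le le_rfl)).symm
    refine le_of_tendsto_of_tendsto hl1 ((hΛ.sub_const _).add_const _) ?_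
    filter_upwards [Ico_mem_nhdsLT ht.2] with s hs
    exact key t s ht.1 hs.1 hs.2
  have h2 := le_of_abs_le ((abs_sub_comm Λ (rayleigh μ c t)).le.trans
    (Y.abs_rayleigh_sub_le (Λ := Λ) ht))
  have h3 := tail_nonneg hE0 ht.1 ht.2.le
  have h4 := transverse_nonneg μ c Λ t
  rw [mul_assoc, le_inv_mul_iff₀ hκ0]
  nlinarith

/-- The modes in the limiting eigenspace converge. -/
lemma exists_neutral_lim (X : ModalFlow μ c F h e a T m M)
    (hint : IntegrableOn (fun τ => transverse μ c Λ τ / (T - τ)) (Ico a T)) :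
    ∃ C ≥ (0 : ℝ), ∀ i, μ i = Λ → ∃ d, Tendsto (c i) (𝓝[<] T) (𝓝 d) ∧
      ∀ t ∈ Ico a T, |c i t - d| ≤
        C * ∫ τ in t..T, (transverse μ c Λ τ / (T - τ) + e τ / (T - τ)) := by
  set D := ∑ i, |μ i - Λ| with hD
  have hD0 : 0 ≤ D := Finset.sum_nonneg fun _ _ => abs_nonneg _
  have hM := X.M_pos
  set C := M * (D + 1) with hC
  have hC0 : 0 ≤ C := by positivity
  set k := fun τ => C * (transverse μ c Λ τ / (T - τ) + e τ / (T - τ)) with hkdef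
  have hk : IntegrableOn k (Ico a T) := (hint.add X.int).const_mul C
  have hW0 : ∀ τ ∈ Ico a T, 0 ≤ transverse μ c Λ τ / (T - τ) := fun τ hτ =>
    div_nonneg (transverse_nonneg _ _ _ _) (sub_pos.2 hτ.2).le
  have hk0 : ∀ τ ∈ Ico a T, 0 ≤ k τ := fun τ hτ =>
    mul_nonneg hC0 (add_nonneg (hW0 τ hτ) (X.drive_nonneg hτ))
  refine ⟨C, hC0, fun i hi => ?_⟩
  have hle : ∀ t ∈ Ioo a T, |h t * (μ i - rayleigh μ c t) * c i t + F i t| ≤ k t := by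
    intro t ht
    have ht' : t ∈ Ico a T := ⟨ht.1.le, ht.2⟩
    have hp : 0 < T - t := sub_pos.2 ht.2
    -- For a neutral mode the factor `Λ - λ` is itself of the order of the transverse part, so the
    -- singular drift is integrable.
    have h1 : |h t * (μ i - rayleigh μ c t) * c i t| ≤
        M / (T - t) * (D * transverse μ c Λ t) * 1 := by
      rw [abs_mul, abs_mul, abs_of_pos (X.coeff_pos ht)]
      have := transverse_nonneg μ c Λ t
      gcongr
      · exact X.coeff_le t ht
      · rw [hi, abs_sub_comm]; exact X.abs_rayleigh_sub_le ht'
      · exact X.abs_le_one i ht'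
    have h2 := X.force i t ht
    refine (abs_add_le _ _).trans ((add_le_add h1 h2).trans ?_)
    have h3 : k t = M / (T - t) * (D * transverse μ c Λ t) * 1
      + M * (transverse μ c Λ t / (T - t)) + M * (e t / (T - t)) + M * D * (e t / (T - t)) := by
      simp only [hkdef, hC]; ring
    have h4 := mul_nonneg hM.le (hW0 t ht')
    have h5 := mul_nonneg (mul_nonneg hM.le hD0) (X.drive_nonneg ht')
    rw [h3]; linarith
  obtain ⟨d, hd⟩ := exists_lim_of_neg_le_deriv (B := 1) X.lt (X.cont i) (X.deriv i) hk hk0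
    (fun t ht => neg_le_of_abs_le (hle t ht))
    (fun t ht => (le_abs_self _).trans (X.abs_le_one i ht))
  refine ⟨d, hd, fun t ht => ?_⟩
  have hsub : Ico t T ⊆ Ico a T := Ico_subset_Ico_left ht.1
  have := abs_sub_lim_le_tail (X.cont i) (X.deriv i) ht.1 ht.2 (hk.mono_set hsub)
    (fun τ hτ => hle τ ⟨ht.1.trans_lt hτ.1, hτ.2⟩) (fun τ hτ => hk0 τ (hsub hτ)) hd
  simpa only [hkdef, intervalIntegral.integral_const_mul] using this

end ModalFlow

end Modal

/-! ### Passage from the matrix to eigencoordinates. -/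

section Spectral

variable {n : ℕ} {A : Matrix (Fin n) (Fin n) ℝ} {b : OrthonormalBasis (Fin n) ℝ (Vec n)}
  {μ : Fin n → ℝ}

lemma op_isSymmetric (hA : A.IsSymm) : (op A).IsSymmetric :=
  Matrix.isSymmetric_toEuclideanLin_iff.2 (by
    rw [Matrix.IsHermitian, Matrix.conjTranspose_eq_transpose_of_trivial]; exact hA)

lemma inner_op (hA : A.IsSymm) (hb : ∀ i, op A (b i) = μ i • b i) (i : Fin n) (x : Vec n) :
    inner ℝ (b i) (op A x) = μ i * inner ℝ (b i) x := by
  rw [← op_isSymmetric hA, hb, real_inner_smul_left]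

lemma norm_sq_eq_sum (b : OrthonormalBasis (Fin n) ℝ (Vec n)) (x : Vec n) :
    ‖x‖ ^ 2 = ∑ i, inner ℝ (b i) x ^ 2 := by
  rw [← b.sum_sq_norm_inner_right x]
  simp

lemma abs_inner_basis_le (b : OrthonormalBasis (Fin n) ℝ (Vec n)) (i : Fin n) (x : Vec n) :
    |inner ℝ (b i) x| ≤ ‖x‖ := by
  have := abs_real_inner_le_norm (b i) x
  rwa [b.norm_eq_one, one_mul] at this

lemma exists_eigenbasis (hA : A.IsSymm) :
    ∃ (b : OrthonormalBasis (Fin n) ℝ (Vec n)) (μ : Fin n → ℝ),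
      (∀ i, op A (b i) = μ i • b i) ∧ eigs A = range μ := by
  have hs := op_isSymmetric hA
  have hn : Module.finrank ℝ (Vec n) = n := finrank_euclideanSpace_fin
  have hb : ∀ i, op A (hs.eigenvectorBasis hn i) = hs.eigenvalues hn i • hs.eigenvectorBasis hn i :=
    fun i => hs.apply_eigenvectorBasis hn i
  refine ⟨hs.eigenvectorBasis hn, hs.eigenvalues hn, hb, Subset.antisymm ?_ ?_⟩
  · intro ν hν
    obtain ⟨x, hx⟩ := Module.End.HasEigenvalue.exists_hasEigenvector hν
    by_contra hcon
    refine hx.2 ?_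
    -- By symmetry, an eigenvector for a value outside the family is orthogonal to every basis
    -- vector.
    have h0 : ‖x‖ ^ 2 = 0 := by
      rw [norm_sq_eq_sum (hs.eigenvectorBasis hn)]
      refine Finset.sum_eq_zero fun i _ => ?_
      have h1 := inner_op hA hb i x
      rw [hx.apply_eq_smul, real_inner_smul_right] at h1
      have h2 : hs.eigenvalues hn i ≠ ν := fun h => hcon ⟨i, h⟩
      have h3 : (hs.eigenvalues hn i - ν) * inner ℝ (hs.eigenvectorBasis hn i) x = 0 := by
        linarith
      rw [(mul_eq_zero.1 h3).resolve_left (sub_ne_zero.2 h2)]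
      simp
    simpa using h0
  · rintro _ ⟨i, rfl⟩
    exact hs.hasEigenvalue_eigenvalues hn i

/-- The projection is self-adjoint and fixes `b i` when `μ i = Λ`; otherwise its range is orthogonal
to `b i`, the eigenvalues being different. -/
lemma inner_proj (hA : A.IsSymm) (hb : ∀ i, op A (b i) = μ i • b i) (Λ : ℝ) (i : Fin n)
    (x : Vec n) [Decidable (μ i = Λ)] :
    inner ℝ (b i) (proj A Λ x) = if μ i = Λ then inner ℝ (b i) x else 0 := by
  split_ifs with hi
  · rw [proj, ← Submodule.inner_starProjection_left_eq_right,
      Submodule.starProjection_eq_self_iff.2]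
    rw [Module.End.mem_eigenspace_iff, hb, hi]
  · have hm : proj A Λ x ∈ Module.End.eigenspace (op A) Λ :=
      Submodule.starProjection_apply_mem _ _
    have h1 := inner_op hA hb i (proj A Λ x)
    rw [Module.End.mem_eigenspace_iff.1 hm, real_inner_smul_right] at h1
    have h3 : (μ i - Λ) * inner ℝ (b i) (proj A Λ x) = 0 := by linarith
    exact (mul_eq_zero.1 h3).resolve_left (sub_ne_zero.2 hi)

/-- The coordinates of the normalized solution. -/
noncomputable def coord (b : OrthonormalBasis (Fin n) ℝ (Vec n)) (y : ℝ → Vec n) (i : Fin n)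
    (t : ℝ) : ℝ :=
  inner ℝ (b i) (normalized y t)

lemma dirichletQuotient_eq (hA : A.IsSymm) (hb : ∀ i, op A (b i) = μ i • b i)
    (y : ℝ → Vec n) : dirichletQuotient A y = rayleigh μ (coord b y) := by
  funext t
  rw [dirichletQuotient, rayleigh, ← b.sum_inner_mul_inner, Finset.sum_div]
  refine Finset.sum_congr rfl fun i _ => ?_
  rw [inner_op hA hb, coord, normalized, real_inner_smul_right, real_inner_comm]
  ring

lemma V1_sq (hA : A.IsSymm) (hb : ∀ i, op A (b i) = μ i • b i) (Λ : ℝ)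
    (y : ℝ → Vec n) (t : ℝ) : V1 A Λ y t ^ 2 = transverse μ (coord b y) Λ t := by
  classical
  rw [V1, norm_sq_eq_sum b, transverse]
  refine Finset.sum_congr rfl fun i _ => ?_
  rw [inner_sub_right, inner_proj hA hb]
  by_cases hi : μ i = Λ
  · simp [hi]
  · simp [hi, coord]

lemma V1_nonneg (A : Matrix (Fin n) (Fin n) ℝ) (Λ : ℝ) (y : ℝ → Vec n) (t : ℝ) :
    0 ≤ V1 A Λ y t := norm_nonneg _

end Spectral

/-! ### The size of the solution near the blow-up time. -/

/-- A blow-up solution of `y' = H(y) A y + f` with a perturbation that is small relative to the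
leading term. -/
structure BlowUpSolution {n : ℕ} (A : Matrix (Fin n) (Fin n) ℝ) (α : ℝ) (H : Vec n → ℝ)
    (t₀ T : ℝ) (y f : ℝ → Vec n) (E0 : ℝ → ℝ) : Prop where
  symm : A.IsSymm
  eigs_pos : ∀ μ ∈ eigs A, 0 < μ
  α_pos : 0 < α
  hom : PosHomogeneous α H
  pos : ∀ x ∈ Metric.sphere (0 : Vec n) 1, 0 < H x
  cont_H : ContinuousOn H (Metric.sphere (0 : Vec n) 1)
  lt : t₀ < T
  cont : ContinuousOn y (Ico t₀ T)
  ne_zero : ∀ t ∈ Ico t₀ T, y t ≠ 0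
  blow : Tendsto (fun t => ‖y t‖) (𝓝[<] T) atTop
  ode : ∀ t ∈ Ioo t₀ T, HasDerivAt y (H (y t) • op A (y t) + f t) t
  force : ∀ t ∈ Ico t₀ T, ‖f t‖ ≤ ‖y t‖ ^ (1 + α) * E0 t
  nonneg : ∀ t ∈ Ico t₀ T, 0 ≤ E0 t
  int : IntegrableOn (fun τ => E0 τ / (T - τ)) (Ico t₀ T)

/-- A function vanishing at `T` is estimated by a weighted tail integral of its derivative. -/
lemma le_sub_mul_tail {φ φ' k : ℝ → ℝ} {a T s : ℝ} (hc : ContinuousOn φ (Ico a T))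
    (hd : ∀ τ ∈ Ioo a T, HasDerivAt φ (φ' τ) τ) (has : a ≤ s) (hsT : s < T)
    (hk : IntegrableOn (fun τ => k τ / (T - τ)) (Ico s T)) (hk0 : ∀ τ ∈ Ico s T, 0 ≤ k τ)
    (hle : ∀ τ ∈ Ioo s T, -k τ ≤ φ' τ) (hl : Tendsto φ (𝓝[<] T) (𝓝 0)) :
    φ s ≤ (T - s) * ∫ τ in s..T, k τ / (T - τ) := by
  have h1 := le_lim_add_tail (k := fun τ => (T - s) * (k τ / (T - τ))) hc hd has hsT
    (hk.const_mul _)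
    (fun τ hτ => mul_nonneg (by linarith)
      (div_nonneg (hk0 τ hτ) (by linarith [hτ.2]))) (fun τ hτ => ?_) hl
  · rwa [intervalIntegral.integral_const_mul, zero_add] at h1
  -- Since `T - τ ≤ T - s`, the bound `k τ` is at most `(T - s) * (k τ / (T - τ))`.
  · refine le_trans (neg_le_neg ?_) (hle τ hτ)
    have hp : 0 < T - τ := sub_pos.2 hτ.2
    rw [mul_div_assoc', le_div_iff₀ hp, mul_comm]
    exact mul_le_mul_of_nonneg_right (by linarith [hτ.1]) (hk0 τ ⟨hτ.1.le, hτ.2⟩)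

namespace BlowUpSolution

variable {n : ℕ} {A : Matrix (Fin n) (Fin n) ℝ} {α : ℝ} {H : Vec n → ℝ} {t₀ T : ℝ}
  {y f : ℝ → Vec n} {E0 : ℝ → ℝ}

lemma norm_pos (S : BlowUpSolution A α H t₀ T y f E0) {t : ℝ} (ht : t ∈ Ico t₀ T) :
    0 < ‖y t‖ := norm_pos_iff.2 (S.ne_zero t ht)

lemma norm_normalized (S : BlowUpSolution A α H t₀ T y f E0) {t : ℝ} (ht : t ∈ Ico t₀ T) :
    ‖normalized y t‖ = 1 := by
  have := S.norm_pos ht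
  rw [normalized, norm_smul, norm_inv, norm_norm, inv_mul_cancel₀ this.ne']

lemma norm_smul_normalized (S : BlowUpSolution A α H t₀ T y f E0) {t : ℝ} (ht : t ∈ Ico t₀ T) :
    ‖y t‖ • normalized y t = y t := by
  rw [normalized, smul_smul, mul_inv_cancel₀ (S.norm_pos ht).ne', one_smul]

lemma H_eq (S : BlowUpSolution A α H t₀ T y f E0) {t : ℝ} (ht : t ∈ Ico t₀ T) :
    H (y t) = ‖y t‖ ^ α * H (normalized y t) := by
  have hv : normalized y t ≠ 0 := norm_pos_iff.1 (by rw [S.norm_normalized ht]; exact one_pos)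
  conv_lhs => rw [← S.norm_smul_normalized ht]
  exact S.hom _ hv _ (S.norm_pos ht)

lemma normalized_cont (S : BlowUpSolution A α H t₀ T y f E0) :
    ContinuousOn (normalized y) (Ico t₀ T) :=
  (S.cont.norm.inv₀ fun _ ht => (S.norm_pos ht).ne').smul S.cont

lemma sum_coord_sq (S : BlowUpSolution A α H t₀ T y f E0)
    (b : OrthonormalBasis (Fin n) ℝ (Vec n)) {t : ℝ} (ht : t ∈ Ico t₀ T) :
    ∑ i, coord b y i t ^ 2 = 1 := by
  simp only [coord]
  rw [← norm_sq_eq_sum, S.norm_normalized ht, one_pow]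

/-- The relative radial component of the perturbation. -/
noncomputable def radialForce (y f : ℝ → Vec n) (t : ℝ) : ℝ :=
  inner ℝ (normalized y t) (f t) / ‖y t‖

lemma abs_force_div_le (S : BlowUpSolution A α H t₀ T y f E0) {t : ℝ} (ht : t ∈ Ico t₀ T)
    {x : Vec n} (hx : ‖x‖ = 1) : |inner ℝ x (f t) / ‖y t‖| ≤ ‖y t‖ ^ α * E0 t := by
  have hp := S.norm_pos ht
  rw [abs_div, abs_of_pos hp, div_le_iff₀ hp]
  have h1 := abs_real_inner_le_norm x (f t)
  rw [hx, one_mul] at h1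
  refine (h1.trans (S.force t ht)).trans_eq ?_
  rw [Real.rpow_add hp, Real.rpow_one]
  ring

lemma norm_deriv (S : BlowUpSolution A α H t₀ T y f E0) {t : ℝ} (ht : t ∈ Ioo t₀ T) :
    HasDerivAt (fun t => ‖y t‖)
      (‖y t‖ * (H (y t) * dirichletQuotient A y t + radialForce y f t)) t := by
  have hp := S.norm_pos ⟨ht.1.le, ht.2⟩
  have h1 := (S.ode t ht).norm_sq.sqrt (pow_pos hp 2).ne'
  simp only [Real.sqrt_sq (norm_nonneg _)] at h1
  refine h1.congr_deriv ?_
  rw [inner_add_right, real_inner_smul_right, radialForce, dirichletQuotient, normalized,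
    real_inner_smul_left]
  field_simp

/-- The quantity `|y|^{-α}`, which vanishes linearly at the blow-up time. -/
noncomputable def invPow (α : ℝ) (y : ℝ → Vec n) (t : ℝ) : ℝ := ‖y t‖ ^ (-α)

lemma invPow_pos (S : BlowUpSolution A α H t₀ T y f E0) {t : ℝ} (ht : t ∈ Ico t₀ T) :
    0 < invPow α y t := Real.rpow_pos_of_pos (S.norm_pos ht) _

lemma norm_rpow_eq (α : ℝ) (y : ℝ → Vec n) (t : ℝ) :
    ‖y t‖ ^ α = (invPow α y t)⁻¹ := by
  rw [invPow, Real.rpow_neg (norm_nonneg _), inv_inv]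

lemma invPow_cont (S : BlowUpSolution A α H t₀ T y f E0) :
    ContinuousOn (invPow α y) (Ico t₀ T) :=
  S.cont.norm.rpow_const fun _ ht => Or.inl (S.norm_pos ht).ne'

lemma invPow_tendsto (S : BlowUpSolution A α H t₀ T y f E0) :
    Tendsto (invPow α y) (𝓝[<] T) (𝓝 0) :=
  (tendsto_rpow_neg_atTop S.α_pos).comp S.blow

/-- The exponent `-α` is chosen so that homogeneity of `H` cancels the growing factor `‖y‖ ^ α`. -/
lemma invPow_deriv (S : BlowUpSolution A α H t₀ T y f E0) {t : ℝ} (ht : t ∈ Ioo t₀ T) :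
    HasDerivAt (invPow α y) (-(α * (H (normalized y t) * dirichletQuotient A y t
      + radialForce y f t * invPow α y t))) t := by
  have ht' : t ∈ Ico t₀ T := ⟨ht.1.le, ht.2⟩
  have hp := S.norm_pos ht'
  refine ((S.norm_deriv ht).rpow_const (p := -α) (Or.inl hp.ne')).congr_deriv ?_
  have hg := S.invPow_pos ht'
  rw [Real.rpow_sub_one hp.ne', S.H_eq ht', norm_rpow_eq]
  change _ * -α * (invPow α y t / ‖y t‖) = _
  field_simp

lemma abs_radialForce_mul_le (S : BlowUpSolution A α H t₀ T y f E0) {t : ℝ}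
    (ht : t ∈ Ico t₀ T) : |radialForce y f t * invPow α y t| ≤ E0 t := by
  have hg := S.invPow_pos ht
  have h1 := S.abs_force_div_le ht (S.norm_normalized ht)
  rw [norm_rpow_eq] at h1
  rw [abs_mul, abs_of_pos hg]
  calc _ ≤ (invPow α y t)⁻¹ * E0 t * invPow α y t := mul_le_mul_of_nonneg_right h1 hg.le
    _ = E0 t := by field_simp

lemma tendsto_const_mul_sub (κ T : ℝ) : Tendsto (fun t => κ * (T - t)) (𝓝[<] T) (𝓝 0) := by
  have : Tendsto (fun t => κ * (T - t)) (𝓝 T) (𝓝 (κ * (T - T))) :=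
    Continuous.tendsto (by fun_prop) T
  rw [sub_self, mul_zero] at this
  exact this.mono_left nhdsWithin_le_nhds

lemma hasDerivAt_const_mul_sub (κ T t : ℝ) : HasDerivAt (fun t => κ * (T - t)) (-κ) t :=
  (((hasDerivAt_id' t).const_sub T).const_mul κ).congr_deriv (by ring)

/-- Comparison with the linear function `κ * (T - t)`, which vanishes at `T` as well; `k` absorbs
both the error in `κ` and the radial force. -/
lemma invPow_upper (S : BlowUpSolution A α H t₀ T y f E0) {s κ : ℝ} {k : ℝ → ℝ}
    (hs : s ∈ Ico t₀ T) (hk : IntegrableOn (fun τ => k τ / (T - τ)) (Ico s T))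
    (hk0 : ∀ τ ∈ Ico s T, 0 ≤ k τ)
    (hle : ∀ τ ∈ Ioo s T, α * (H (normalized y τ) * dirichletQuotient A y τ) + α * E0 τ
      ≤ κ + k τ) :
    invPow α y s ≤ (T - s) * (κ + ∫ τ in s..T, k τ / (T - τ)) := by
  have h := le_sub_mul_tail (φ := fun t => invPow α y t - κ * (T - t))
    (S.invPow_cont.sub (by fun_prop))
    (fun τ hτ => (S.invPow_deriv hτ).sub (hasDerivAt_const_mul_sub κ T τ)) hs.1 hs.2 hk hk0
    (fun τ hτ => by
      have h1 := hle τ hτ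
      have h2 := le_of_abs_le (S.abs_radialForce_mul_le ⟨hs.1.trans hτ.1.le, hτ.2⟩)
      have h3 := mul_le_mul_of_nonneg_left h2 S.α_pos.le
      linarith)
    (by simpa using S.invPow_tendsto.sub (tendsto_const_mul_sub κ T))
  linarith

lemma invPow_lower (S : BlowUpSolution A α H t₀ T y f E0) {s κ : ℝ} {k : ℝ → ℝ}
    (hs : s ∈ Ico t₀ T) (hk : IntegrableOn (fun τ => k τ / (T - τ)) (Ico s T))
    (hk0 : ∀ τ ∈ Ico s T, 0 ≤ k τ)
    (hle : ∀ τ ∈ Ioo s T, κ + α * E0 τ ≤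
      α * (H (normalized y τ) * dirichletQuotient A y τ) + k τ) :
    (T - s) * (κ - ∫ τ in s..T, k τ / (T - τ)) ≤ invPow α y s := by
  have h := le_sub_mul_tail (φ := fun t => κ * (T - t) - invPow α y t)
    (ContinuousOn.sub (by fun_prop) S.invPow_cont)
    (fun τ hτ => (hasDerivAt_const_mul_sub κ T τ).sub (S.invPow_deriv hτ)) hs.1 hs.2 hk hk0
    (fun τ hτ => by
      have h1 := hle τ hτ
      have h2 := neg_le_of_abs_le (S.abs_radialForce_mul_le ⟨hs.1.trans hτ.1.le, hτ.2⟩)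
      have h3 := mul_le_mul_of_nonneg_left h2 S.α_pos.le
      linarith)
    (by simpa using (tendsto_const_mul_sub κ T).sub S.invPow_tendsto)
  linarith

lemma exists_H_bounds (S : BlowUpSolution A α H t₀ T y f E0) :
    ∃ l > (0 : ℝ), ∃ L > (0 : ℝ), ∀ t ∈ Ico t₀ T,
      l ≤ H (normalized y t) ∧ H (normalized y t) ≤ L := by
  have hmem : ∀ t ∈ Ico t₀ T, normalized y t ∈ Metric.sphere (0 : Vec n) 1 := fun t ht => by
    simpa using S.norm_normalized ht
  have hne : (Metric.sphere (0 : Vec n) 1).Nonempty := ⟨_, hmem t₀ ⟨le_rfl, S.lt⟩⟩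
  obtain ⟨p, hp, hpm⟩ := (isCompact_sphere (0 : Vec n) 1).exists_isMinOn hne S.cont_H
  obtain ⟨q, hq, hqm⟩ := (isCompact_sphere (0 : Vec n) 1).exists_isMaxOn hne S.cont_H
  exact ⟨H p, S.pos p hp, H q, S.pos q hq, fun t ht => ⟨hpm (hmem t ht), hqm (hmem t ht)⟩⟩

lemma exists_dirichlet_bounds (S : BlowUpSolution A α H t₀ T y f E0) :
    ∃ l > (0 : ℝ), ∃ L > (0 : ℝ), ∀ t ∈ Ico t₀ T,
      l ≤ dirichletQuotient A y t ∧ dirichletQuotient A y t ≤ L := by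
  obtain ⟨b, μ, hb, hμ⟩ := exists_eigenbasis S.symm
  have hpos : ∀ i, 0 < μ i := fun i => S.eigs_pos _ (hμ ▸ mem_range_self i)
  obtain ⟨l, hl, hl0⟩ : ∃ l, (∀ i, l ≤ μ i) ∧ 0 < l := by
    have h1 : ∀ i, ∀ᶠ l in 𝓝[>] (0 : ℝ), l ≤ μ i := fun i => by
      filter_upwards [Ioo_mem_nhdsGT (hpos i)] with l hl using hl.2.le
    exact ((eventually_all.2 h1).and self_mem_nhdsWithin).exists
  refine ⟨l, hl0, 1 + ∑ i, μ i, add_pos_of_pos_of_nonneg one_pos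
    (Finset.sum_nonneg fun i _ => (hpos i).le), fun t ht => ?_⟩
  rw [dirichletQuotient_eq S.symm hb, rayleigh]
  have hsum := S.sum_coord_sq b ht
  constructor
  · calc l = ∑ i, l * coord b y i t ^ 2 := by rw [← Finset.mul_sum, hsum, mul_one]
      _ ≤ _ := Finset.sum_le_sum fun i _ =>
        mul_le_mul_of_nonneg_right (hl i) (sq_nonneg _)
  · have : ∑ i, μ i * coord b y i t ^ 2 ≤ ∑ i, μ i := by
      refine Finset.sum_le_sum fun i _ => mul_le_of_le_one_right (hpos i).le ?_
      rw [← hsum]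
      exact Finset.single_le_sum (f := fun i => coord b y i t ^ 2) (fun i _ => sq_nonneg _)
        (Finset.mem_univ i)
    linarith

/-- Near the blow-up time `|y|^{-α}` is comparable with `T - t`. -/
lemma exists_invPow_bounds (S : BlowUpSolution A α H t₀ T y f E0) :
    ∃ p > (0 : ℝ), ∃ P > (0 : ℝ), ∃ a ∈ Ico t₀ T, ∀ t ∈ Ico a T,
      p * (T - t) ≤ invPow α y t ∧ invPow α y t ≤ P * (T - t) := by
  obtain ⟨l, hl, L, hL, hH⟩ := S.exists_H_bounds
  obtain ⟨l', hl', L', hL', hD⟩ := S.exists_dirichlet_bounds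
  have hα := S.α_pos
  set κ := α * (l * l') with hκ
  have hκ0 : 0 < κ := by positivity
  have hkint : IntegrableOn (fun τ => α * E0 τ / (T - τ)) (Ico t₀ T) := by
    simp only [mul_div_assoc]
    exact S.int.const_mul α
  have hk0 : ∀ τ ∈ Ico t₀ T, 0 ≤ α * E0 τ := fun τ hτ => mul_nonneg hα.le (S.nonneg τ hτ)
  -- Beyond `a` the forcing costs at most half of the lower rate `κ`.
  obtain ⟨a, ha, hsmall⟩ := exists_Ico_of_eventually S.lt
    ((tail_tendsto S.lt hkint).eventually (eventually_lt_nhds (half_pos hκ0)))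
  refine ⟨κ / 2, half_pos hκ0, α * (L * L') + κ / 2, by positivity, a, ha, fun t ht => ?_⟩
  have ht' : t ∈ Ico t₀ T := ⟨ha.1.trans ht.1, ht.2⟩
  have hsub : Ico t T ⊆ Ico t₀ T := Ico_subset_Ico_left ht'.1
  have hp : 0 < T - t := sub_pos.2 ht.2
  have h0 := hsmall t ht
  constructor
  · have h1 := S.invPow_lower (κ := κ) ht' (hkint.mono_set hsub) (fun τ hτ => hk0 τ (hsub hτ))
      (fun τ hτ => by
        have hτ' := hsub ⟨hτ.1.le, hτ.2⟩
        have : κ ≤ α * (H (normalized y τ) * dirichletQuotient A y τ) := by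
          have h1 := (hH τ hτ').1
          have h2 := (hD τ hτ').1
          have h3 := hl.trans_le h1
          rw [hκ]; gcongr
        linarith)
    nlinarith
  · have h1 := S.invPow_upper (κ := α * (L * L')) ht' (hkint.mono_set hsub)
      (fun τ hτ => hk0 τ (hsub hτ))
      (fun τ hτ => by
        have hτ' := hsub ⟨hτ.1.le, hτ.2⟩
        have : α * (H (normalized y τ) * dirichletQuotient A y τ) ≤ α * (L * L') := by
          have h1 := (hH τ hτ').2
          have h2 := (hD τ hτ').2
          have h3 := hl'.trans_le (hD τ hτ').1
          gcongr
        linarith)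
    nlinarith

/-- Normalization subtracts the radial growth rate, `H(y) λ` plus the radial force, from the rate of
each mode. -/
lemma coord_deriv (S : BlowUpSolution A α H t₀ T y f E0) {b : OrthonormalBasis (Fin n) ℝ (Vec n)}
    {μ : Fin n → ℝ} (hb : ∀ i, op A (b i) = μ i • b i) (i : Fin n) {t : ℝ} (ht : t ∈ Ioo t₀ T) :
    HasDerivAt (coord b y i) (H (y t) * (μ i - rayleigh μ (coord b y) t) * coord b y i t
      + (inner ℝ (b i) (f t) / ‖y t‖ - radialForce y f t * coord b y i t)) t := by
  have hp := S.norm_pos ⟨ht.1.le, ht.2⟩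
  have h1 : HasDerivAt (fun t => inner ℝ (b i) (y t))
      (H (y t) * (μ i * inner ℝ (b i) (y t)) + inner ℝ (b i) (f t)) t := by
    have := (hasDerivAt_const t (b i)).inner ℝ (S.ode t ht)
    rw [inner_zero_left, add_zero, inner_add_right, real_inner_smul_right,
      inner_op S.symm hb] at this
    exact this
  have h2 := ((S.norm_deriv ht).inv hp.ne').mul h1
  have h3 : coord b y i = (fun t => ‖y t‖)⁻¹ * fun t => inner ℝ (b i) (y t) := by
    funext t
    simp [coord, normalized, real_inner_smul_right]
  refine (h3 ▸ h2).congr_deriv ?_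
  rw [dirichletQuotient_eq S.symm hb]
  have h4 : coord b y i t = ‖y t‖⁻¹ * inner ℝ (b i) (y t) := by
    simp [coord, normalized, real_inner_smul_right]
  rw [h4]
  simp only [Pi.inv_apply]
  field_simp
  ring

/-- The normalized solution is a modal flow near the blow-up time. -/
lemma exists_modalFlow (S : BlowUpSolution A α H t₀ T y f E0)
    {b : OrthonormalBasis (Fin n) ℝ (Vec n)} {μ : Fin n → ℝ}
    (hb : ∀ i, op A (b i) = μ i • b i) :
    ∃ a ∈ Ico t₀ T, ∃ m M, ModalFlow μ (coord b y)
      (fun i t => inner ℝ (b i) (f t) / ‖y t‖ - radialForce y f t * coord b y i t)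
      (fun t => H (y t)) E0 a T m M := by
  obtain ⟨l, hl, L, hL, hH⟩ := S.exists_H_bounds
  obtain ⟨p, hp, P, hP, a, ha, hg⟩ := S.exists_invPow_bounds
  have hsub : Ico a T ⊆ Ico t₀ T := Ico_subset_Ico_left ha.1
  have hsub' : Ioo a T ⊆ Ico a T := Ioo_subset_Ico_self
  -- `L / p` bounds `H(y)`; `2 / p` bounds the two force terms, each at most `E0 / (p (T - t))`.
  refine ⟨a, ha, l / P, max (L / p) (2 / p), ?_⟩
  exact
    { lt := ha.2
      m_pos := div_pos hl hP
      M_pos := lt_max_of_lt_left (div_pos hL hp)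
      cont := fun i => (ContinuousOn.inner continuousOn_const S.normalized_cont).mono hsub
      sum_sq := fun t ht => S.sum_coord_sq b (hsub ht)
      deriv := fun i t ht => S.coord_deriv hb i (Ioo_subset_Ioo_left ha.1 ht)
      le_coeff := fun t ht => by
        have ht' := hsub' ht
        have hT : 0 < T - t := sub_pos.2 ht.2
        rw [S.H_eq (hsub ht'), norm_rpow_eq, div_div, div_eq_inv_mul]
        have := S.invPow_pos (hsub ht')
        have h1 := (hg t ht').2
        have h2 := (hH t (hsub ht')).1
        gcongr
      coeff_le := fun t ht => by
        have ht' := hsub' ht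
        have hT : 0 < T - t := sub_pos.2 ht.2
        have h0 : L / p / (T - t) ≤ max (L / p) (2 / p) / (T - t) := by
          gcongr; exact le_max_left _ _
        refine le_trans ?_ h0
        rw [S.H_eq (hsub ht'), norm_rpow_eq, div_div, div_eq_inv_mul]
        have h1 := (hg t ht').1
        have h2 := (hH t (hsub ht')).2
        have h3 := hl.trans_le (hH t (hsub ht')).1
        gcongr
      force := fun i t ht => by
        have ht' := hsub' ht
        have hT : 0 < T - t := sub_pos.2 ht.2
        have hE := S.nonneg t (hsub ht')
        have h1 := S.abs_force_div_le (hsub ht') (b.norm_eq_one i)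
        have h2 := S.abs_force_div_le (hsub ht') (S.norm_normalized (hsub ht'))
        have h3 : |coord b y i t| ≤ 1 :=
          (abs_inner_basis_le b i _).trans_eq (S.norm_normalized (hsub ht'))
        have h4 : |radialForce y f t * coord b y i t| ≤ ‖y t‖ ^ α * E0 t := by
          rw [abs_mul]
          exact (mul_le_of_le_one_right (abs_nonneg _) h3).trans h2
        have h5 : ‖y t‖ ^ α * E0 t ≤ (p * (T - t))⁻¹ * E0 t := by
          rw [norm_rpow_eq]
          have h1 := (hg t ht').1
          gcongr
        have h6 : 2 / p * (E0 t / (T - t)) ≤ max (L / p) (2 / p) * (E0 t / (T - t)) := by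
          have := le_max_right (L / p) (2 / p)
          gcongr
        refine (abs_sub _ _).trans (le_trans ?_ h6)
        have h7 : 2 / p * (E0 t / (T - t)) = 2 * ((p * (T - t))⁻¹ * E0 t) := by
          field_simp
        linarith
      nonneg := fun t ht => S.nonneg t (hsub ht)
      int := S.int.mono_set hsub }

end BlowUpSolution

/-! ### Extreme eigenvalues and the delayed starting time. -/

section Eigenvalues

variable {n : ℕ} {A : Matrix (Fin n) (Fin n) ℝ} {μ : Fin n → ℝ}

lemma eigMin_le (hμ : eigs A = range μ) (i : Fin n) : eigMin A ≤ μ i := by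
  rw [eigMin, hμ]
  exact csInf_le (finite_range μ).bddBelow (mem_range_self i)

lemma le_eigMax (hμ : eigs A = range μ) (i : Fin n) : μ i ≤ eigMax A := by
  rw [eigMax, hμ]
  exact le_csSup (finite_range μ).bddAbove (mem_range_self i)

lemma norm_le_sum_abs_inner (b : OrthonormalBasis (Fin n) ℝ (Vec n)) (x : Vec n) :
    ‖x‖ ≤ ∑ i, |inner ℝ (b i) x| := by
  conv_lhs => rw [← b.sum_repr' x]
  refine (norm_sum_le _ _).trans (Finset.sum_le_sum fun i _ => ?_)
  rw [norm_smul, b.norm_eq_one, mul_one, Real.norm_eq_abs]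

lemma norm_proj_le (A : Matrix (Fin n) (Fin n) ℝ) (Λ : ℝ) (x : Vec n) : ‖proj A Λ x‖ ≤ ‖x‖ :=
  Submodule.norm_starProjection_apply_le _ _

end Eigenvalues

lemma tendsto_sub_rpow {T ε : ℝ} (hε : 0 < ε) :
    Tendsto (fun t => (T - t) ^ ε) (𝓝[<] T) (𝓝 0) := by
  have h1 : Tendsto (fun t => T - t) (𝓝[<] T) (𝓝 0) := by
    simpa using BlowUpSolution.tendsto_const_mul_sub 1 T
  have h2 := h1.rpow_const (p := ε) (Or.inr hε.le)
  rwa [Real.zero_rpow hε.ne'] at h2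

lemma tendsto_delayed_time {T ε : ℝ} (hε : 0 < ε) :
    Tendsto (fun t => T - (T - t) ^ ε) (𝓝[<] T) (𝓝[<] T) := by
  refine tendsto_nhdsWithin_iff.2 ⟨?_, ?_⟩
  · simpa using (tendsto_sub_rpow (T := T) hε).const_sub T
  · filter_upwards [self_mem_nhdsWithin] with t ht
    have : 0 < (T - t) ^ ε := Real.rpow_pos_of_pos (sub_pos.2 (mem_Iio.1 ht)) _
    exact mem_Iio.2 (by linarith)

lemma le_sqrt_mul_of_sq_le {x C p : ℝ} (hC : 0 ≤ C) (h : x ^ 2 ≤ C * p) :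
    x ≤ √C * √p := by
  rw [← Real.sqrt_mul hC]
  exact Real.le_sqrt_of_sq_le h

/-! ### Convergence rates and the blow-up profile. -/

namespace BlowUpSolution

variable {n : ℕ} {A : Matrix (Fin n) (Fin n) ℝ} {α : ℝ} {H : Vec n → ℝ} {t₀ T : ℝ}
  {y f : ℝ → Vec n} {E0 : ℝ → ℝ} {Λ : ℝ}

lemma V1_le_one (S : BlowUpSolution A α H t₀ T y f E0) {t : ℝ} (ht : t ∈ Ico t₀ T) :
    V1 A Λ y t ≤ 1 := by
  obtain ⟨b, μ, hb, -⟩ := exists_eigenbasis S.symm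
  have h1 : V1 A Λ y t ^ 2 ≤ 1 := by
    rw [V1_sq S.symm hb, ← S.sum_coord_sq b ht]
    refine Finset.sum_le_sum fun i _ => ?_
    split_ifs
    · positivity
    · exact le_rfl
  nlinarith [V1_nonneg A Λ y t]

lemma exists_dirichlet_lim (S : BlowUpSolution A α H t₀ T y f E0) :
    ∃ Λ ∈ eigs A, Tendsto (dirichletQuotient A y) (𝓝[<] T) (𝓝 Λ) := by
  obtain ⟨b, μ, hb, hμ⟩ := exists_eigenbasis S.symm
  obtain ⟨a, ha, m, M, X⟩ := S.exists_modalFlow hb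
  obtain ⟨Λ, hΛ⟩ := X.exists_rayleigh_lim
  obtain ⟨i, hi⟩ := X.lim_mem_range hΛ
  exact ⟨Λ, hμ ▸ ⟨i, hi⟩, by rwa [dirichletQuotient_eq S.symm hb]⟩

lemma V1_eq_zero (S : BlowUpSolution A α H t₀ T y f E0) (hΛ : Λ ∈ eigs A)
    (heq : eigMin A = eigMax A) (t : ℝ) : V1 A Λ y t = 0 := by
  obtain ⟨b, μ, hb, hμ⟩ := exists_eigenbasis S.symm
  obtain ⟨j, rfl⟩ := hμ ▸ hΛ
  have h1 : V1 A (μ j) y t ^ 2 = 0 := by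
    rw [V1_sq S.symm hb]
    refine Finset.sum_eq_zero fun i _ => if_pos ?_
    have := eigMin_le hμ i
    have := eigMin_le hμ j
    have := le_eigMax hμ i
    have := le_eigMax hμ j
    linarith
  simpa using h1

lemma V1_isBigO_of_eigMin (S : BlowUpSolution A α H t₀ T y f E0)
    (hlim : Tendsto (dirichletQuotient A y) (𝓝[<] T) (𝓝 Λ))
    (hq : IntegrableOn (fun τ => (T - τ)⁻¹ * E0 τ ^ 2) (Ico t₀ T)) (hmin : eigMin A = Λ) :
    V1 A Λ y =O[𝓝[<] T] E2 E0 T := by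
  obtain ⟨b, μ, hb, hμ⟩ := exists_eigenbasis S.symm
  obtain ⟨a, ha, m, M, X⟩ := S.exists_modalFlow hb
  rw [dirichletQuotient_eq S.symm hb] at hlim
  obtain ⟨η, -, C, hC, a', ha', hbd, -⟩ := X.exists_transverse_bounds hlim
    (hq.mono_set (Ico_subset_Ico_left ha.1))
  refine IsBigO.of_bound (√C) ?_
  filter_upwards [Ico_mem_nhdsLT ha'.2] with t ht
  rw [Real.norm_of_nonneg (V1_nonneg A Λ y t), E2, Real.norm_of_nonneg (Real.sqrt_nonneg _)]
  refine le_sqrt_mul_of_sq_le hC ?_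
  rw [V1_sq S.symm hb]
  exact hbd (fun i => hmin ▸ eigMin_le hμ i) t ht

lemma exists_V1_isBigO (S : BlowUpSolution A α H t₀ T y f E0)
    (hlim : Tendsto (dirichletQuotient A y) (𝓝[<] T) (𝓝 Λ))
    (hq : IntegrableOn (fun τ => (T - τ)⁻¹ * E0 τ ^ 2) (Ico t₀ T)) :
    ∃ θ₀ : ℝ, 0 < θ₀ ∧ ∀ ε ∈ Ioo (0 : ℝ) 1, V1 A Λ y =O[𝓝[<] T]
      fun t => (T - t) ^ ((1 - ε) * θ₀) + E2 E0 T (T - (T - t) ^ ε) := by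
  obtain ⟨b, μ, hb, hμ⟩ := exists_eigenbasis S.symm
  obtain ⟨a, ha, m, M, X⟩ := S.exists_modalFlow hb
  rw [dirichletQuotient_eq S.symm hb] at hlim
  obtain ⟨η, hη, C, hC, a', ha', -, hbd⟩ := X.exists_transverse_bounds hlim
    (hq.mono_set (Ico_subset_Ico_left ha.1))
  -- The exponent is halved because the transverse estimate controls `V1 ^ 2`.
  refine ⟨η / 2, half_pos hη, fun ε hε => IsBigO.of_bound (√C) ?_⟩
  filter_upwards [(tendsto_delayed_time hε.1).eventually (Ico_mem_nhdsLT ha'.2),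
    Ico_mem_nhdsLT (sub_one_lt T), self_mem_nhdsWithin] with t hs ht1 htT
  have htT : t < T := htT
  have hp : 0 < T - t := sub_pos.2 htT
  -- The stable estimate is started at this delayed time, which precedes `t` because `T - t ≤ 1`.
  -- The power then becomes `(T - t) ^ ((1 - ε) * η)` before the square root.
  have hst : T - (T - t) ^ ε ≤ t := by
    have h1 : (T - t) ^ (1 : ℝ) ≤ (T - t) ^ ε :=
      Real.rpow_le_rpow_of_exponent_ge hp (by linarith [ht1.1]) hε.2.le
    rw [Real.rpow_one] at h1
    linarith
  have h1 := hbd _ t hs.1 hst htT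
  rw [← V1_sq S.symm hb] at h1
  have h2 := le_sqrt_mul_of_sq_le hC h1
  have hpow : √((T - t) ^ η * (T - (T - (T - t) ^ ε)) ^ (-η)) = (T - t) ^ ((1 - ε) * (η / 2)) := by
    rw [sub_sub_cancel, ← Real.rpow_mul hp.le, ← Real.rpow_add hp, Real.sqrt_eq_rpow,
      ← Real.rpow_mul hp.le]
    congr 1
    ring
  have h3 : √((T - t) ^ η * (T - (T - (T - t) ^ ε)) ^ (-η)
      + ∫ τ in (T - (T - t) ^ ε)..T, (T - τ)⁻¹ * E0 τ ^ 2)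
      ≤ (T - t) ^ ((1 - ε) * (η / 2)) + E2 E0 T (T - (T - t) ^ ε) := by
    rw [← hpow, E2]
    refine Real.sqrt_le_iff.2 ⟨by positivity, ?_⟩
    have h4 : 0 ≤ (T - t) ^ η * (T - (T - (T - t) ^ ε)) ^ (-η) := by
      rw [sub_sub_cancel]; positivity
    have h5 : 0 ≤ ∫ τ in (T - (T - t) ^ ε)..T, (T - τ)⁻¹ * E0 τ ^ 2 :=
      tail_nonneg (a := T - (T - t) ^ ε) (fun τ hτ =>
        mul_nonneg (inv_nonneg.2 (sub_pos.2 hτ.2).le) (sq_nonneg _)) le_rfl hs.2.le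
    rw [add_sq, Real.sq_sqrt h4, Real.sq_sqrt h5]
    have := mul_nonneg (mul_nonneg zero_le_two (Real.sqrt_nonneg
      ((T - t) ^ η * (T - (T - (T - t) ^ ε)) ^ (-η)))) (Real.sqrt_nonneg
      (∫ τ in (T - (T - t) ^ ε)..T, (T - τ)⁻¹ * E0 τ ^ 2))
    linarith
  rw [Real.norm_of_nonneg (V1_nonneg A Λ y t)]
  exact h2.trans (mul_le_mul_of_nonneg_left (h3.trans (le_abs_self _)) (Real.sqrt_nonneg _))

lemma V1_tendsto_zero (S : BlowUpSolution A α H t₀ T y f E0) (hΛ : Λ ∈ eigs A)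
    (hlim : Tendsto (dirichletQuotient A y) (𝓝[<] T) (𝓝 Λ))
    (hq : eigMin A < eigMax A → IntegrableOn (fun τ => (T - τ)⁻¹ * E0 τ ^ 2) (Ico t₀ T)) :
    Tendsto (V1 A Λ y) (𝓝[<] T) (𝓝 0) := by
  obtain ⟨b, μ, hb, hμ⟩ := exists_eigenbasis S.symm
  obtain ⟨j, hj⟩ := hμ ▸ hΛ
  rcases ((eigMin_le hμ j).trans (le_eigMax hμ j)).eq_or_lt with heq | hlt
  · simp only [funext (S.V1_eq_zero hΛ heq), tendsto_const_nhds]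
  · obtain ⟨θ, hθ, hO⟩ := S.exists_V1_isBigO hlim (hq hlt)
    refine (hO (1 / 2) (by norm_num)).trans_tendsto ?_
    have h1 : Tendsto (E2 E0 T) (𝓝[<] T) (𝓝 0) := by
      have := (tail_tendsto S.lt (hq hlt)).sqrt
      rwa [Real.sqrt_zero] at this
    have h2 := (tendsto_sub_rpow (T := T) (ε := (1 - 1 / 2) * θ) (by positivity)).add
      (h1.comp (tendsto_delayed_time (T := T) (ε := 1 / 2) (by norm_num)))
    rwa [add_zero] at h2

/-- The component in the limiting eigenspace converges at an integral rate. -/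
lemma exists_profile_direction (S : BlowUpSolution A α H t₀ T y f E0)
    (hlim : Tendsto (dirichletQuotient A y) (𝓝[<] T) (𝓝 Λ)) :
    ∃ vstar : Vec n, ∃ C ≥ (0 : ℝ), ∃ a ∈ Ico t₀ T,
      IntegrableOn (fun τ => V1 A Λ y τ ^ 2 / (T - τ)) (Ico a T) ∧
      (∀ t ∈ Ico a T, ‖proj A Λ (normalized y t) - vstar‖ ≤
        C * ∫ τ in t..T, (V1 A Λ y τ ^ 2 / (T - τ) + E0 τ / (T - τ))) ∧
      ∀ t ∈ Ico a T, ∫ τ in t..T, (V1 A Λ y τ ^ 2 / (T - τ) + E0 τ / (T - τ)) ≤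
        C * (V1 A Λ y t ^ 2 + E1 E0 T t) := by
  classical
  obtain ⟨b, μ, hb, hμ⟩ := exists_eigenbasis S.symm
  obtain ⟨a₁, ha₁, m, M, X⟩ := S.exists_modalFlow hb
  rw [dirichletQuotient_eq S.symm hb] at hlim
  obtain ⟨C, hC, a, ha, hint, hbd⟩ := X.exists_transverse_integrable hlim
  obtain ⟨K, hK, hd⟩ := (X.restrict ha).exists_neutral_lim hint
  simp only [V1_sq S.symm hb]
  choose! d hd using hd
  have ha' : a ∈ Ico t₀ T := ⟨ha₁.1.trans ha.1, ha.2⟩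
  have hEint : IntegrableOn (fun τ => E0 τ / (T - τ)) (Ico a T) :=
    S.int.mono_set (Ico_subset_Ico_left ha'.1)
  -- The limiting direction collects the limits of the neutral coordinates and has no transverse
  -- part.
  set vstar : Vec n := ∑ i, (if μ i = Λ then d i else 0) • b i with hvstar
  have hcoord : ∀ i, inner ℝ (b i) vstar = if μ i = Λ then d i else 0 := fun i => by
    rw [hvstar, b.orthonormal.inner_right_fintype]
  have hnn : ∀ t ∈ Ico a T, 0 ≤ ∫ τ in t..T,
      (transverse μ (coord b y) Λ τ / (T - τ) + E0 τ / (T - τ)) := fun t ht =>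
    tail_nonneg (a := a) (fun τ hτ => add_nonneg
      (div_nonneg (transverse_nonneg _ _ _ _) (sub_pos.2 hτ.2).le)
      ((X.restrict ha).drive_nonneg hτ)) ht.1 ht.2.le
  refine ⟨vstar, max (∑ _i : Fin n, K) (C + 1), le_max_of_le_right (by positivity), a, ha', hint,
    fun t ht => ?_, fun t ht => ?_⟩
  · refine (norm_le_sum_abs_inner b _).trans (le_trans ?_
      (mul_le_mul_of_nonneg_right (le_max_left _ _) (hnn t ht)))
    rw [Finset.sum_mul]
    refine Finset.sum_le_sum fun i _ => ?_
    rw [inner_sub_right, inner_proj S.symm hb, hcoord]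
    split_ifs with hi
    · exact (hd i hi).2 t ht
    · rw [sub_zero, abs_zero]
      exact mul_nonneg hK (hnn t ht)
  · rw [intervalIntegral.integral_add (intervalIntegrable_of_Ico hint ht.1 ht.2.le le_rfl)
      (intervalIntegrable_of_Ico hEint ht.1 ht.2.le le_rfl)]
    have h1 := hbd t ht
    have h2 : 0 ≤ E1 E0 T t :=
      tail_nonneg (fun τ hτ => (X.restrict ha).drive_nonneg hτ) ht.1 ht.2.le
    have h3 := transverse_nonneg μ (coord b y) Λ t
    refine le_trans ?_ (mul_le_mul_of_nonneg_right (le_max_right _ _) (add_nonneg h3 h2))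
    change _ + E1 E0 T t ≤ _
    change _ ≤ C * (_ + E1 E0 T t) at h1
    linarith

lemma exists_abs_dirichlet_sub_le (S : BlowUpSolution A α H t₀ T y f E0) (Λ : ℝ) :
    ∃ D ≥ (0 : ℝ), ∃ a ∈ Ico t₀ T, ∀ t ∈ Ico a T,
      |dirichletQuotient A y t - Λ| ≤ D * V1 A Λ y t ^ 2 := by
  obtain ⟨b, μ, hb, hμ⟩ := exists_eigenbasis S.symm
  obtain ⟨a, ha, m, M, X⟩ := S.exists_modalFlow hb
  refine ⟨∑ i, |μ i - Λ|, Finset.sum_nonneg fun _ _ => abs_nonneg _, a, ha, fun t ht => ?_⟩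
  rw [dirichletQuotient_eq S.symm hb, V1_sq S.symm hb]
  exact X.abs_rayleigh_sub_le ht

/-- Lets the quadratic errors in `V1` be absorbed by the terms linear in `V1` in `calE0` and in the
rates. -/
lemma V1_sq_le (S : BlowUpSolution A α H t₀ T y f E0) {t : ℝ} (ht : t ∈ Ico t₀ T) :
    V1 A Λ y t ^ 2 ≤ V1 A Λ y t := by
  nlinarith [V1_nonneg A Λ y t, S.V1_le_one (Λ := Λ) ht]

/-- The rescaled inverse power of the norm converges at the rate `calE1`. -/
lemma exists_abs_invPow_sub_le (S : BlowUpSolution A α H t₀ T y f E0) {vstar : Vec n}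
    (hv : ‖vstar‖ = 1) {s₀ : ℝ} {ω : ℝ → ℝ} (hω : IsModulusAt H vstar s₀ ω) {T₁ : ℝ}
    (hT₁ : T₁ ∈ Ico t₀ T) (hV2 : ∀ t ∈ Ico T₁ T, V2 y vstar t ≤ s₀)
    (hint : IntegrableOn (fun τ => calE0 A Λ y E0 vstar ω τ / (T - τ)) (Ico T₁ T)) :
    ∃ K ≥ (0 : ℝ), ∃ a ∈ Ico T₁ T, ∀ t ∈ Ico a T,
      |invPow α y t / (T - t) - α * Λ * H vstar| ≤ K * calE1 A Λ y E0 vstar ω T t := by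
  obtain ⟨D, hD, a₁, ha₁, hDbd⟩ := S.exists_abs_dirichlet_sub_le Λ
  obtain ⟨l, hl, L, hL, hdir⟩ := S.exists_dirichlet_bounds
  have hα := S.α_pos
  have hH : 0 < H vstar := S.pos vstar (by simpa using hv)
  -- The summands account for the variation of `H`, the deviation of the Dirichlet quotient from
  -- `Λ`, and the force.
  set K := α * (L + H vstar * D + 1) with hK
  have hK0 : 0 ≤ K := by positivity
  set a := max a₁ T₁ with ha
  have haT : a < T := max_lt ha₁.2 hT₁.2
  have ha₁a : a₁ ≤ a := le_max_left _ _
  have hT₁a : T₁ ≤ a := le_max_right _ _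
  have hV2nn : ∀ t, 0 ≤ V2 y vstar t := fun t => norm_nonneg _
  have hωnn : ∀ t ∈ Ico a T, 0 ≤ ω (V2 y vstar t) := fun t ht =>
    hω.nonneg _ ⟨hV2nn t, hV2 t ⟨hT₁a.trans ht.1, ht.2⟩⟩
  have hcal : ∀ t ∈ Ico a T, 0 ≤ calE0 A Λ y E0 vstar ω t := fun t ht =>
    add_nonneg (add_nonneg (hωnn t ht) (V1_nonneg _ _ _ _))
      (S.nonneg t ⟨hT₁.1.trans (hT₁a.trans ht.1), ht.2⟩)
  have hmain : ∀ t ∈ Ico a T,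
      |α * (H (normalized y t) * dirichletQuotient A y t) - α * Λ * H vstar| + α * E0 t
        ≤ K * calE0 A Λ y E0 vstar ω t := by
    intro t ht
    have ht0 : t ∈ Ico t₀ T := ⟨hT₁.1.trans (hT₁a.trans ht.1), ht.2⟩
    have h1 : |H (normalized y t) - H vstar| ≤ ω (V2 y vstar t) :=
      hω.bound _ (S.norm_normalized ht0) (hV2 t ⟨hT₁a.trans ht.1, ht.2⟩)
    have h2 := (hDbd t ⟨ha₁a.trans ht.1, ht.2⟩).trans
      (mul_le_mul_of_nonneg_left (S.V1_sq_le (Λ := Λ) ht0) hD)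
    have h3 : α * (H (normalized y t) * dirichletQuotient A y t) - α * Λ * H vstar
        = α * (dirichletQuotient A y t * (H (normalized y t) - H vstar)
          + H vstar * (dirichletQuotient A y t - Λ)) := by ring
    have h4 : |dirichletQuotient A y t * (H (normalized y t) - H vstar)|
        ≤ L * ω (V2 y vstar t) := by
      rw [abs_mul, abs_of_pos (hl.trans_le (hdir t ht0).1)]
      exact mul_le_mul (hdir t ht0).2 h1 (abs_nonneg _) hL.le
    have h5 : |H vstar * (dirichletQuotient A y t - Λ)| ≤ H vstar * (D * V1 A Λ y t) := by
      rw [abs_mul, abs_of_pos hH]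
      exact mul_le_mul_of_nonneg_left h2 hH.le
    rw [h3, abs_mul, abs_of_pos hα, ← mul_add, hK, mul_assoc]
    refine mul_le_mul_of_nonneg_left ?_ hα.le
    have h6 := abs_add_le (dirichletQuotient A y t * (H (normalized y t) - H vstar))
      (H vstar * (dirichletQuotient A y t - Λ))
    have h7 := hωnn t ht
    have h8 := V1_nonneg A Λ y t
    have h9 := S.nonneg t ht0
    have h10 : (L + H vstar * D + 1) * calE0 A Λ y E0 vstar ω t
      = L * ω (V2 y vstar t) + H vstar * (D * V1 A Λ y t) + E0 t
        + (L * (V1 A Λ y t + E0 t) + H vstar * D * (ω (V2 y vstar t) + E0 t)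
          + (ω (V2 y vstar t) + V1 A Λ y t)) := by
      rw [calE0]; ring
    have h11 : 0 ≤ L * (V1 A Λ y t + E0 t) + H vstar * D * (ω (V2 y vstar t) + E0 t)
          + (ω (V2 y vstar t) + V1 A Λ y t) := by positivity
    rw [h10]
    linarith
  have hKint : IntegrableOn (fun τ => K * calE0 A Λ y E0 vstar ω τ / (T - τ)) (Ico T₁ T) := by
    simp only [mul_div_assoc]
    exact hint.const_mul K
  refine ⟨K, hK0, a, ⟨hT₁a, haT⟩, fun t ht => ?_⟩
  have ht0 : t ∈ Ico t₀ T := ⟨hT₁.1.trans (hT₁a.trans ht.1), ht.2⟩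
  have hp : 0 < T - t := sub_pos.2 ht.2
  have hsub : Ico t T ⊆ Ico a T := Ico_subset_Ico_left ht.1
  have hI := hKint.mono_set (Ico_subset_Ico_left (hT₁a.trans ht.1))
  have hup := S.invPow_upper (κ := α * Λ * H vstar) ht0 hI
    (fun τ hτ => mul_nonneg hK0 (hcal τ (hsub hτ))) (fun τ hτ => by
      have h1 := hmain τ (hsub ⟨hτ.1.le, hτ.2⟩)
      have h2 := le_abs_self
        (α * (H (normalized y τ) * dirichletQuotient A y τ) - α * Λ * H vstar)
      linarith)
  have hlo := S.invPow_lower (κ := α * Λ * H vstar) ht0 hI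
    (fun τ hτ => mul_nonneg hK0 (hcal τ (hsub hτ))) (fun τ hτ => by
      have h1 := hmain τ (hsub ⟨hτ.1.le, hτ.2⟩)
      have h2 := neg_le_abs
        (α * (H (normalized y τ) * dirichletQuotient A y τ) - α * Λ * H vstar)
      linarith)
  simp only [mul_div_assoc, intervalIntegral.integral_const_mul] at hup hlo
  have hup' := (div_le_iff₀' hp).2 hup
  have hlo' := (le_div_iff₀' hp).2 hlo
  rw [calE1, abs_le]
  constructor <;> linarith

lemma rpow_mul_norm_eq (S : BlowUpSolution A α H t₀ T y f E0) {t : ℝ} (ht : t ∈ Ico t₀ T) :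
    (T - t) ^ (1 / α) * ‖y t‖ = (invPow α y t / (T - t)) ^ (-(1 / α)) := by
  have hp : 0 < T - t := sub_pos.2 ht.2
  have hα := S.α_pos
  rw [Real.div_rpow (S.invPow_pos ht).le hp.le, invPow, ← Real.rpow_mul (norm_nonneg _),
    Real.rpow_neg hp.le, div_inv_eq_mul, neg_mul_neg, mul_one_div_cancel hα.ne', Real.rpow_one,
    mul_comm]

/-- The blow-up profile of the solution. -/
lemma exists_blowup_profile (S : BlowUpSolution A α H t₀ T y f E0) (hΛ : Λ ∈ eigs A)
    {vstar : Vec n} (hv : ‖vstar‖ = 1) (heig : vstar ∈ Module.End.eigenspace (op A) Λ)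
    (hlim : Tendsto (normalized y) (𝓝[<] T) (𝓝 vstar))
    {C : ℝ} (hC : 0 ≤ C) {a : ℝ} (ha : a ∈ Ico t₀ T)
    (hVint : IntegrableOn (fun τ => V1 A Λ y τ ^ 2 / (T - τ)) (Ico a T))
    (hrate : ∀ t ∈ Ico a T, ‖proj A Λ (normalized y t) - vstar‖ ≤
        C * ∫ τ in t..T, (V1 A Λ y τ ^ 2 / (T - τ) + E0 τ / (T - τ)))
    {s₀ : ℝ} {ω : ℝ → ℝ} (hω : IsModulusAt H vstar s₀ ω) {T₁ : ℝ}
    (hT₁ : T₁ ∈ Ico t₀ T) (hV2 : ∀ t ∈ Ico T₁ T, V2 y vstar t ≤ s₀)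
    (hint : IntegrableOn (fun τ => calE0 A Λ y E0 vstar ω τ / (T - τ)) (Ico T₁ T)) :
    ∃ ξ : Vec n, ξ ≠ 0 ∧
      Tendsto (fun t => (T - t) ^ (1 / α) • y t) (𝓝[<] T) (𝓝 ξ) ∧
      Module.End.HasEigenvector (op A) Λ ξ ∧
      α * Λ * H ξ = 1 ∧
      (fun t => (T - t) ^ (1 / α) * ‖y t - proj A Λ (y t)‖) =O[𝓝[<] T] V1 A Λ y ∧
      (fun t => ‖(T - t) ^ (1 / α) • proj A Λ (y t) - ξ‖)
        =O[𝓝[<] T] calE1 A Λ y E0 vstar ω T ∧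
      (fun t => ‖(T - t) ^ (1 / α) • y t - ξ‖)
        =O[𝓝[<] T] (fun t => V1 A Λ y t + calE1 A Λ y E0 vstar ω T t) := by
  have hα := S.α_pos
  have hΛ0 := S.eigs_pos Λ hΛ
  have hH : 0 < H vstar := S.pos vstar (by simpa using hv)
  have hv0 : vstar ≠ 0 := norm_pos_iff.1 (by rw [hv]; exact one_pos)
  set κ := α * Λ * H vstar with hκ
  have hκ0 : 0 < κ := by positivity
  obtain ⟨K, hK, a₂, ha₂, hg⟩ := S.exists_abs_invPow_sub_le (Λ := Λ) hv hω hT₁ hV2 hint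
  set cE := calE1 A Λ y E0 vstar ω T with hcE
  have hcal : ∀ t ∈ Ico T₁ T, 0 ≤ calE0 A Λ y E0 vstar ω t := fun t ht =>
    add_nonneg (add_nonneg (hω.nonneg _ ⟨norm_nonneg _, hV2 t ht⟩) (V1_nonneg _ _ _ _))
      (S.nonneg t ⟨hT₁.1.trans ht.1, ht.2⟩)
  have hcE0 : ∀ t ∈ Ico T₁ T, 0 ≤ cE t := fun t ht =>
    tail_nonneg (fun τ hτ => div_nonneg (hcal τ hτ) (sub_pos.2 hτ.2).le) ht.1 ht.2.le
  have hcElim : Tendsto cE (𝓝[<] T) (𝓝 0) := tail_tendsto hT₁.2 hint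
  set ρ : ℝ → ℝ := fun t => (invPow α y t / (T - t)) ^ (-(1 / α)) with hρ
  set ρs : ℝ := κ ^ (-(1 / α)) with hρs
  have hρs0 : 0 < ρs := Real.rpow_pos_of_pos hκ0 _
  have hrO : (fun t => invPow α y t / (T - t) - κ) =O[𝓝[<] T] cE := by
    refine IsBigO.of_bound K ?_
    filter_upwards [Ico_mem_nhdsLT ha₂.2] with t ht
    exact (hg t ht).trans (mul_le_mul_of_nonneg_left (le_abs_self _) hK)
  have hrlim : Tendsto (fun t => invPow α y t / (T - t)) (𝓝[<] T) (𝓝 κ) := by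
    have := (hrO.trans_tendsto hcElim).add_const κ
    simpa using this
  -- The power `-(1 / α)` is differentiable at `κ > 0`, so the rate carries over.
  have hρO : (fun t => ρ t - ρs) =O[𝓝[<] T] cE :=
    ((Real.hasDerivAt_rpow_const (p := -(1 / α)) (Or.inl hκ0.ne')).isBigO_sub.comp_tendsto
      hrlim).trans hrO
  have hρlim : Tendsto ρ (𝓝[<] T) (𝓝 ρs) :=
    hrlim.rpow_const (Or.inl hκ0.ne')
  have hscale : ∀ t ∈ Ico t₀ T, (T - t) ^ (1 / α) • y t = ρ t • normalized y t := by
    intro t ht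
    conv_lhs => rw [← S.norm_smul_normalized ht, smul_smul, S.rpow_mul_norm_eq ht]
  have hscaleR : ∀ t ∈ Ico t₀ T,
      (T - t) ^ (1 / α) • proj A Λ (y t) = ρ t • proj A Λ (normalized y t) := fun t ht => by
    rw [← map_smul, hscale t ht, map_smul]
  have hV1O : (fun t => (T - t) ^ (1 / α) * ‖y t - proj A Λ (y t)‖) =O[𝓝[<] T] V1 A Λ y := by
    have h1 : (fun t => ρ t * V1 A Λ y t) =O[𝓝[<] T] fun t => (1 : ℝ) * V1 A Λ y t :=
      (hρlim.isBigO_one ℝ).mul (isBigO_refl _ _)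
    simp only [one_mul] at h1
    refine h1.congr' ?_ EventuallyEq.rfl
    filter_upwards [Ico_mem_nhdsLT S.lt] with t ht
    have hp : 0 ≤ (T - t) ^ (1 / α) := Real.rpow_nonneg (sub_pos.2 ht.2).le _
    have hρt : 0 ≤ ρ t := Real.rpow_nonneg
      (div_nonneg (S.invPow_pos ht).le (sub_pos.2 ht.2).le) _
    rw [V1, ← Real.norm_of_nonneg hp, ← norm_smul, smul_sub, hscale t ht, hscaleR t ht,
      ← smul_sub, norm_smul, Real.norm_of_nonneg hρt]
  have hRO : (fun t => ‖(T - t) ^ (1 / α) • proj A Λ (y t) - ρs • vstar‖) =O[𝓝[<] T] cE := by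
    have h1 : (fun t => proj A Λ (normalized y t) - vstar) =O[𝓝[<] T] cE := by
      refine IsBigO.of_bound C ?_
      filter_upwards [Ico_mem_nhdsLT ha.2, Ico_mem_nhdsLT hT₁.2] with t ht ht₁
      refine (hrate t ht).trans (mul_le_mul_of_nonneg_left (le_trans ?_ (le_abs_self _)) hC)
      have hE := S.int.mono_set (Ico_subset_Ico_left (ha.1.trans ht.1))
      refine tail_mono (a := t) ((hVint.mono_set (Ico_subset_Ico_left ht.1)).add hE)
        (hint.mono_set (Ico_subset_Ico_left ht₁.1)) (fun τ hτ => ?_) le_rfl ht.2.le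
      have hp : 0 < T - τ := sub_pos.2 hτ.2
      rw [← add_div]
      refine div_le_div_of_nonneg_right ?_ hp.le
      have h2 := S.V1_sq_le (Λ := Λ) ⟨ha.1.trans (ht.1.trans hτ.1), hτ.2⟩
      have h3 := hω.nonneg (V2 y vstar τ) ⟨norm_nonneg _, hV2 τ ⟨ht₁.1.trans hτ.1, hτ.2⟩⟩
      rw [calE0]
      linarith
    have h2 : (fun t => proj A Λ (normalized y t)) =O[𝓝[<] T] fun _ => (1 : ℝ) := by
      refine IsBigO.of_bound 1 ?_
      filter_upwards [Ico_mem_nhdsLT S.lt] with t ht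
      have := (norm_proj_le A Λ (normalized y t)).trans_eq (S.norm_normalized ht)
      simpa using this
    have h3 := hρO.smul h2
    have h4 := h3.add ((h1.const_smul_left ρs).trans (isBigO_of_le _ fun t => by simp :
      cE =O[𝓝[<] T] fun t => cE t • (1 : ℝ)))
    simp only [smul_eq_mul, mul_one] at h4
    refine (h4.norm_left).congr' ?_ EventuallyEq.rfl
    filter_upwards [Ico_mem_nhdsLT S.lt] with t ht
    -- With `R` for the projection, the error splits as `(ρ - ρs) R v + ρs (R v - v_*)`, where `R v`
    -- is bounded.
    rw [hscaleR t ht]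
    congr 1
    simp only [sub_smul, smul_sub, Pi.smul_apply]
    abel
  have hsmul0 : ρs • vstar ≠ 0 := smul_ne_zero hρs0.ne' hv0
  refine ⟨ρs • vstar, hsmul0, ?_, ⟨Submodule.smul_mem _ _ heig, hsmul0⟩, ?_, hV1O, hRO, ?_⟩
  · refine (hρlim.smul hlim).congr' ?_
    filter_upwards [Ico_mem_nhdsLT S.lt] with t ht
    exact (hscale t ht).symm
  -- Homogeneity gives `H(ρs v_*) = ρs ^ α H(v_*)`, and `ρs ^ α` is the inverse of `κ = α Λ H(v_*)`.
  · rw [S.hom vstar hv0 ρs hρs0, hρs, ← Real.rpow_mul hκ0.le, neg_mul,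
      one_div_mul_cancel hα.ne', Real.rpow_neg_one, mul_left_comm, ← hκ,
      inv_mul_cancel₀ hκ0.ne']
  · have hsum1 : V1 A Λ y =O[𝓝[<] T] fun t => V1 A Λ y t + cE t := by
      refine IsBigO.of_bound 1 ?_
      filter_upwards [Ico_mem_nhdsLT hT₁.2] with t ht
      have := hcE0 t ht
      have := V1_nonneg A Λ y t
      rw [one_mul, Real.norm_of_nonneg ‹_›, Real.norm_of_nonneg (by positivity)]
      linarith
    have hsum2 : cE =O[𝓝[<] T] fun t => V1 A Λ y t + cE t := by
      refine IsBigO.of_bound 1 ?_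
      filter_upwards [Ico_mem_nhdsLT hT₁.2] with t ht
      have h1 := hcE0 t ht
      have h2 := V1_nonneg A Λ y t
      rw [one_mul, Real.norm_of_nonneg h1, Real.norm_of_nonneg (by positivity)]
      linarith
    refine IsBigO.trans ?_ ((hV1O.trans hsum1).add (hRO.trans hsum2))
    refine IsBigO.of_bound 1 ?_
    filter_upwards [Ico_mem_nhdsLT S.lt] with t ht
    have hp : 0 ≤ (T - t) ^ (1 / α) := Real.rpow_nonneg (sub_pos.2 ht.2).le _
    rw [norm_norm, one_mul]
    refine le_trans ?_ (le_abs_self _)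
    have h1 : (T - t) ^ (1 / α) • y t - ρs • vstar
        = (T - t) ^ (1 / α) • (y t - proj A Λ (y t))
          + ((T - t) ^ (1 / α) • proj A Λ (y t) - ρs • vstar) := by
      rw [smul_sub]; abel
    rw [h1]
    refine (norm_add_le _ _).trans_eq ?_
    rw [norm_smul, Real.norm_of_nonneg hp]

end BlowUpSolution

end BlowUp

/-! ### Assembly of the theorem. -/

theorem mainTheorem4 (n : ℕ) (A : Matrix (Fin n) (Fin n) ℝ) (hA : A.IsSymm)
    (hApos : ∀ μ ∈ eigs A, 0 < μ)
    (α : ℝ) (hα : 0 < α) (H : Vec n → ℝ) (hHhom : PosHomogeneous α H)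
    (hHpos : ∀ x ∈ Metric.sphere (0 : Vec n) 1, 0 < H x)
    (hHcont : ContinuousOn H (Metric.sphere (0 : Vec n) 1))
    (t₀ T : ℝ) (ht₀ : 0 ≤ t₀) (hT : t₀ < T)
    (y f : ℝ → Vec n) (E0 : ℝ → ℝ)
    (hyC1 : ContDiffOn ℝ 1 y (Ico t₀ T))
    (hy0 : ∀ t ∈ Ico t₀ T, y t ≠ 0)
    (hyblow : Tendsto (fun t => ‖y t‖) (𝓝[<] T) atTop)
    (hyode : ∀ t ∈ Ioo t₀ T, HasDerivAt y (H (y t) • op A (y t) + f t) t)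
    (hf : ContinuousOn f (Ico t₀ T))
    (hfE : ∀ t ∈ Ico t₀ T, ‖f t‖ ≤ ‖y t‖ ^ (1 + α) * E0 t)
    (hE0 : ∀ t ∈ Ico t₀ T, 0 ≤ E0 t)
    (hE0int : IntegrableOn E0 (Ico t₀ T))
    (hZ1 : IntegrableOn (fun τ => E0 τ / (T - τ)) (Ico t₀ T)) :
    ∃ Λ ∈ eigs A,
      Tendsto (dirichletQuotient A y) (𝓝[<] T) (𝓝 Λ) ∧
      -- the part of the normalized solution outside the eigenspace
      ((eigMin A < eigMax A → IntegrableOn (fun τ => (T - τ)⁻¹ * E0 τ ^ 2) (Ico t₀ T)) →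
        (Tendsto (fun t => normalized y t - proj A Λ (normalized y t)) (𝓝[<] T) (𝓝 0) ∧
          (eigMin A = eigMax A → ∀ t ∈ Ico t₀ T, V1 A Λ y t = 0) ∧
          (eigMin A = Λ → Λ < eigMax A → V1 A Λ y =O[𝓝[<] T] E2 E0 T) ∧
          (eigMin A < Λ → ∃ θ₀ : ℝ, 0 < θ₀ ∧ ∀ ε ∈ Ioo (0 : ℝ) 1,
            V1 A Λ y =O[𝓝[<] T]
              fun t => (T - t) ^ ((1 - ε) * θ₀) + E2 E0 T (T - (T - t) ^ ε))) ∧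
        -- convergence of the normalized solution
        (IntegrableOn (fun τ => E1 E0 T τ / (T - τ)) (Ico t₀ T) →
          ∃ vstar : Vec n, ‖vstar‖ = 1 ∧
            (fun t => ‖proj A Λ (normalized y t) - vstar‖)
              =O[𝓝[<] T] (fun t => V1 A Λ y t + E1 E0 T t) ∧
            Tendsto (normalized y) (𝓝[<] T) (𝓝 vstar) ∧
            V2 y vstar =O[𝓝[<] T] (fun t => V1 A Λ y t + E1 E0 T t) ∧
            -- asymptotic behaviour of the solution itself
            ∀ (s₀ : ℝ) (ω : ℝ → ℝ), IsModulusAt H vstar s₀ ω →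
              ∀ T₁ ∈ Ico t₀ T, (∀ t ∈ Ico T₁ T, V2 y vstar t ≤ s₀) →
                IntegrableOn (fun τ => calE0 A Λ y E0 vstar ω τ / (T - τ)) (Ico T₁ T) →
                ∃ ξ : Vec n, ξ ≠ 0 ∧
                  Tendsto (fun t => (T - t) ^ (1 / α) • y t) (𝓝[<] T) (𝓝 ξ) ∧
                  Module.End.HasEigenvector (op A) Λ ξ ∧
                  α * Λ * H ξ = 1 ∧
                  (fun t => (T - t) ^ (1 / α) * ‖y t - proj A Λ (y t)‖)
                    =O[𝓝[<] T] V1 A Λ y ∧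
                  (fun t => ‖(T - t) ^ (1 / α) • proj A Λ (y t) - ξ‖)
                    =O[𝓝[<] T] calE1 A Λ y E0 vstar ω T ∧
                  (fun t => ‖(T - t) ^ (1 / α) • y t - ξ‖)
                    =O[𝓝[<] T] (fun t => V1 A Λ y t + calE1 A Λ y E0 vstar ω T t))) := by
  have S : BlowUpSolution A α H t₀ T y f E0 :=
    { symm := hA, eigs_pos := hApos, α_pos := hα, hom := hHhom, pos := hHpos, cont_H := hHcont,
      lt := hT, cont := hyC1.continuousOn, ne_zero := hy0, blow := hyblow, ode := hyode,
      force := hfE, nonneg := hE0, int := hZ1 }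
  obtain ⟨Λ, hΛ, hlim⟩ := S.exists_dirichlet_lim
  obtain ⟨b, μ, hb, hμ⟩ := exists_eigenbasis hA
  have hmax : Λ ≤ eigMax A := by
    obtain ⟨j, rfl⟩ := hμ ▸ hΛ
    exact le_eigMax hμ j
  refine ⟨Λ, hΛ, hlim, fun hq => ?_⟩
  have hV1 := S.V1_tendsto_zero hΛ hlim hq
  have hw : Tendsto (fun t => normalized y t - proj A Λ (normalized y t)) (𝓝[<] T) (𝓝 0) :=
    tendsto_zero_iff_norm_tendsto_zero.2 hV1
  refine ⟨⟨hw, fun heq t _ => S.V1_eq_zero hΛ heq t, fun h1 h2 =>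
    S.V1_isBigO_of_eigMin hlim (hq (h1 ▸ h2)) h1, fun h1 =>
    S.exists_V1_isBigO hlim (hq (h1.trans_le hmax))⟩, fun _ => ?_⟩
  obtain ⟨vstar, C, hC, a, ha, hVint, hrate, hbd⟩ := S.exists_profile_direction hlim
  have hEint := hZ1.mono_set (Ico_subset_Ico_left (b := T) ha.1)
  have hE1nn : ∀ t ∈ Ico a T, 0 ≤ E1 E0 T t := fun t ht =>
    tail_nonneg (fun τ hτ => div_nonneg (hE0 τ hτ) (sub_pos.2 hτ.2).le) (ha.1.trans ht.1) ht.2.le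
  have hRlim : Tendsto (fun t => proj A Λ (normalized y t)) (𝓝[<] T) (𝓝 vstar) := by
    rw [tendsto_iff_norm_sub_tendsto_zero]
    have h1 := (tail_tendsto ha.2 (hVint.add hEint)).const_mul C
    rw [mul_zero] at h1
    refine tendsto_of_tendsto_of_tendsto_of_le_of_le' tendsto_const_nhds h1
      (Eventually.of_forall fun _ => norm_nonneg _) ?_
    filter_upwards [Ico_mem_nhdsLT ha.2] with t ht using hrate t ht
  have hvlim : Tendsto (normalized y) (𝓝[<] T) (𝓝 vstar) := by
    simpa using hw.add hRlim
  have hv1 : ‖vstar‖ = 1 := by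
    refine tendsto_nhds_unique hvlim.norm (tendsto_const_nhds.congr' ?_)
    filter_upwards [Ico_mem_nhdsLT hT] with t ht using (S.norm_normalized ht).symm
  -- Both `v` and its projection tend to `vstar`; continuity of the projection makes `vstar` a fixed
  -- point.
  have heig : vstar ∈ Module.End.eigenspace (op A) Λ :=
    Submodule.starProjection_eq_self_iff.1
      (tendsto_nhds_unique (((proj A Λ).continuous.tendsto vstar).comp hvlim) hRlim)
  -- One factor `C` comes from the convergence estimate, the other from bounding its tail integral
  -- by `V1 ^ 2 + E1`.
  have hRle : ∀ t ∈ Ico a T, ‖proj A Λ (normalized y t) - vstar‖ ≤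
      C * C * (V1 A Λ y t + E1 E0 T t) := fun t ht => by
    refine (hrate t ht).trans ?_
    rw [mul_assoc]
    refine mul_le_mul_of_nonneg_left ((hbd t ht).trans ?_) hC
    have := S.V1_sq_le (Λ := Λ) ⟨ha.1.trans ht.1, ht.2⟩
    gcongr
  refine ⟨vstar, hv1, ?_, hvlim, ?_, fun s₀ ω hω T₁ hT₁ hV2 hint =>
    S.exists_blowup_profile hΛ hv1 heig hvlim hC ha hVint hrate hω hT₁ hV2 hint⟩
  · refine IsBigO.of_bound (C * C) ?_
    filter_upwards [Ico_mem_nhdsLT ha.2] with t ht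
    rw [norm_norm]
    exact (hRle t ht).trans (mul_le_mul_of_nonneg_left (le_abs_self _) (mul_nonneg hC hC))
  · refine IsBigO.of_bound (1 + C * C) ?_
    filter_upwards [Ico_mem_nhdsLT ha.2] with t ht
    have h1 := hRle t ht
    have h2 := hE1nn t ht
    have h3 := V1_nonneg A Λ y t
    rw [V2, norm_norm, Real.norm_of_nonneg (add_nonneg h3 h2)]
    have h4 := norm_sub_le_norm_sub_add_norm_sub (normalized y t)
      (proj A Λ (normalized y t)) vstar
    change _ ≤ V1 A Λ y t + _ at h4
    linarith
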